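/- **Lemma (Weil).** Let $k$ be any field and let $X$ be a smooth projective curve over $k$, that is, an integral closed subscheme of some $\mathbb P^N_k$ that is smooth of relative dimension $1$ over $k$ (smooth and connected implies integral). Let $\eta$ be the generic point of $X$ and $F=\mathcal O_{X,\eta}$ the function field. For a closed point $x\in X$ let $F_x$ be the completion of $F$ at $x$ and $\mathcal O_x\subset F_x$ its ring of integers. Let $\mathbb A=\prod'_x F_x$ be the ring of adèles, i.e. the families $(f_x)_x\in\prod_x F_x$, indexed by the closed points of $X$, with $f_x\in\mathcal O_x$ for all but finitely many $x$; let $\mathcal O=\prod_x\mathcal O_x\subset\mathbb A$, and embed $F$ diagonally in $\mathbb A$. Then for every integer $n\ge 0$ there is a bijection $$\Phi\colon\ GL_n(F)\backslash GL_n(\mathbb A)/GL_n(\mathcal O)\ \xrightarrow{\ \sim\ }\ \{\text{vector bundles of rank } n \text{ on } X\}/\cong ,$$ where a vector bundle of rank $n$ is an $\mathcal O_X$-module that is locally isomorphic to $\mathcal O_X^{\oplus n}$. This bijection is given by transition functions: for every $g=(g_x)_x\in GL_n(\mathbb A)$ and every vector bundle $\mathcal V$ of rank $n$ on $X$, the class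 of $g$ corresponds to the class of $\mathcal V$ under $\Phi$ if and only if there are an $F$-basis $(e_i)$ of the generic stalk $\mathcal V_\eta$ and, for each closed point $x$, an $\mathcal O_x$-basis $(f_{x,j})$ of $\mathcal O_x\otimes_{\mathcal O_{X,x}}\mathcal V_x$ such that $f_{x,j}=\sum_i (g_x)_{ij}\,e_i$ in $F_x\otimes_F\mathcal V_\eta$ for all $x$ and $j$. -/

import Mathlib

open AlgebraicGeometry CategoryTheory TopologicalSpace
open scoped TensorProduct RestrictedProduct

universe u

/-! ### Local rings of smooth curves are discrete valuation rings -/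

section LocalRings

/-- The localization of an étale algebra over a principal ideal domain (not a field, Jacobson)
at a maximal ideal is a discrete valuation ring. -/
theorem isDVR_of_etale (R S : Type u) [CommRing R] [IsDomain R] [IsPrincipalIdealRing R]
    [IsJacobsonRing R] (hR : ¬ IsField R) [CommRing S] [IsDomain S] [Algebra R S]
    [Algebra.Etale R S] (q : Ideal S) [hq : q.IsMaximal] :
    IsDiscreteValuationRing (Localization.AtPrime q) := by
  let L := Localization.AtPrime q
  have : IsNoetherianRing S := Algebra.FiniteType.isNoetherianRing R S
  have : IsNoetherianRing L := IsLocalization.isNoetherianRing q.primeCompl L inferInstance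
  have hinj : Function.Injective (algebraMap R S) := by
    have : Module.Flat R S := inferInstance
    exact FaithfulSMul.algebraMap_injective R S
  have hpmax : (q.under R).IsMaximal := by
    let _ : Field (S ⧸ q) := Ideal.Quotient.field q
    have : Module.Finite R (S ⧸ q) := finite_of_finite_type_of_isJacobsonRing R (S ⧸ q)
    have h := Ideal.IsMaximal.under R (⊥ : Ideal (S ⧸ q))
    convert h using 1
    ext r
    rw [Ideal.mem_comap, Ideal.mem_comap, Ideal.mem_bot,
      IsScalarTower.algebraMap_apply R S (S ⧸ q)]
    exact Ideal.Quotient.eq_zero_iff_mem.symm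
  have hq0 : q ≠ ⊥ := by
    rintro rfl
    refine Ring.ne_bot_of_isMaximal_of_not_isField hpmax hR ?_
    ext r
    rw [Ideal.mem_comap, Ideal.mem_bot, Ideal.mem_bot, map_eq_zero_iff _ hinj]
  have hL : ¬ IsField L := IsLocalization.AtPrime.not_isField S hq0 L
  have hm : (IsLocalRing.maximalIdeal L).IsPrincipal := by
    let _ := Localization.AtPrime.algebraOfLiesOver (q.under R) q
    have h1 := ((Algebra.isUnramifiedAt_iff_map_eq R (q.under R) q).mp inferInstance).2
    rw [← h1]
    infer_instance
  exact ((IsDiscreteValuationRing.TFAE L hL).out 4 0).mp hm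

theorem stalk_isDVR {k : Type u} [Field k] {X : Scheme.{u}} [IsIntegral X]
    (f : X ⟶ Spec (.of k)) [SmoothOfRelativeDimension 1 f] (x : X) (hx : IsClosed {x}) :
    IsDiscreteValuationRing (X.presheaf.stalk x) := by
  obtain ⟨U, hU, V, hV, hxV, e, h⟩ :=
    SmoothOfRelativeDimension.exists_isStandardSmoothOfRelativeDimension (n := 1) (f := f) x
  have hUtop : U = ⊤ := by
    have := e hxV
    ext y
    simpa [Subsingleton.elim y (f x)] using this
  subst hUtop
  have hA : IsField Γ(Spec (.of k), ⊤) :=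
    MulEquiv.isField (Field.toIsField k)
      (Scheme.ΓSpecIso (.of k)).commRingCatIsoToRingEquiv.toMulEquiv
  let _ : Field Γ(Spec (.of k), ⊤) := hA.toField
  obtain ⟨g, -, hg⟩ := h.exists_etale_mvPolynomial
  algebraize [g]
  have : Nonempty V := ⟨⟨x, hxV⟩⟩
  let _ : Algebra Γ(X, V) (X.presheaf.stalk x) := (X.presheaf.germ V x hxV).hom.toAlgebra
  have : IsLocalization.AtPrime (X.presheaf.stalk x) (hV.primeIdealOf ⟨x, hxV⟩).asIdeal :=
    hV.isLocalization_stalk ⟨x, hxV⟩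
  have := hV.primeIdealOf_isMaximal_of_isClosed ⟨x, hxV⟩ hx
  have : IsPrincipalIdealRing (MvPolynomial (Fin 1) Γ(Spec (.of k), ⊤)) :=
    IsPrincipalIdealRing.of_surjective
      (MvPolynomial.uniqueAlgEquiv Γ(Spec (.of k), ⊤) (Fin 1)).symm (AlgEquiv.surjective _)
  have hR : ¬ IsField (MvPolynomial (Fin 1) Γ(Spec (.of k), ⊤)) := fun hF ↦
    Polynomial.not_isField _ (MulEquiv.isField hF
      (MvPolynomial.uniqueAlgEquiv Γ(Spec (.of k), ⊤) (Fin 1)).symm.toMulEquiv)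
  have := isDVR_of_etale (MvPolynomial (Fin 1) Γ(Spec (.of k), ⊤)) Γ(X, V) hR
    (hV.primeIdealOf ⟨x, hxV⟩).asIdeal
  exact IsDiscreteValuationRing.RingEquivClass.isDiscreteValuationRing
    (IsLocalization.algEquiv (hV.primeIdealOf ⟨x, hxV⟩).asIdeal.primeCompl
      (Localization.AtPrime (hV.primeIdealOf ⟨x, hxV⟩).asIdeal) (X.presheaf.stalk x))

theorem isClosed_of_ne_genericPoint {X : Scheme.{u}} [IsIntegral X] [CompactSpace X]
    (h : ∀ x : X, IsClosed {x} → IsDiscreteValuationRing (X.presheaf.stalk x))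
    (y : X) (hy : y ≠ genericPoint X) : IsClosed {y} := by
  obtain ⟨x, hxy, hx⟩ := isClosed_closure.exists_closed_singleton
    (Set.singleton_nonempty y).closure
  have hyx : y ⤳ x := specializes_iff_mem_closure.mpr hxy
  have := h x hx
  have hr := Scheme.range_fromSpecStalk (X := X) (x := x)
  obtain ⟨p, rfl⟩ : y ∈ Set.range (X.fromSpecStalk x) := hr ▸ hyx
  obtain ⟨q, hq⟩ : genericPoint X ∈ Set.range (X.fromSpecStalk x) :=
    hr ▸ (genericPoint_spec X).specializes trivial
  by_cases hp : p.asIdeal = ⊥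
  · exfalso
    apply hy
    have h1 : p ⤳ q := by
      refine (PrimeSpectrum.le_iff_specializes p q).mp ?_
      change p.asIdeal ≤ q.asIdeal
      simp [hp]
    have h2 := h1.map (X.fromSpecStalk x).continuous
    rw [hq] at h2
    exact h2.antisymm ((genericPoint_spec X).specializes trivial) |>.eq
  · have : p = IsLocalRing.closedPoint _ := by
      apply PrimeSpectrum.ext
      exact IsLocalRing.eq_maximalIdeal (p.2.isMaximal hp)
    rw [this, Scheme.fromSpecStalk_closedPoint]
    exact hx

theorem finite_compl_of_genericPoint_mem {X : Scheme.{u}} [IsIntegral X] [NoetherianSpace X]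
    (h : ∀ x : X, IsClosed {x} → IsDiscreteValuationRing (X.presheaf.stalk x))
    (U : X.Opens) (hU : genericPoint X ∈ U) : {x : X | x ∉ U}.Finite := by
  obtain ⟨S, hS, hS1, hS2, hS3⟩ := NoetherianSpace.exists_finite_set_isClosed_irreducible
    (s := {x : X | x ∉ U}) U.isOpen.isClosed_compl
  rw [hS3]
  refine hS.sUnion fun t ht ↦ ?_
  have h2 := (hS2 t ht)
  obtain ⟨ξ, hξ⟩ := QuasiSober.sober h2 (hS1 t ht)
  have : ξ ∈ {x : X | x ∉ U} := hS3 ▸ Set.mem_sUnion_of_mem hξ.mem ht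
  have hcl := isClosed_of_ne_genericPoint h ξ (by rintro rfl; exact this hU)
  have : t = {ξ} := by rw [← hξ.def, hcl.closure_eq]
  simp [this]

end LocalRings

/-! ### Smooth projective curves -/

section Curve

attribute [local instance] MvPolynomial.gradedAlgebra

/-- Projective space `ℙᴺ` over a field `k`, that is `Proj k[x₀, …, x_N]`. -/
noncomputable abbrev ProjectiveSpaceOver (k : Type u) [Field k] (N : ℕ) : Scheme.{u} :=
  Proj (MvPolynomial.homogeneousSubmodule (Fin (N + 1)) k)

/-- The structure morphism `ℙᴺ ⟶ Spec k`. -/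
noncomputable def ProjectiveSpaceOver.str (k : Type u) [Field k] (N : ℕ) :
    ProjectiveSpaceOver k N ⟶ Spec (.of k) :=
  Proj.toSpecZero (MvPolynomial.homogeneousSubmodule (Fin (N + 1)) k) ≫
    Spec.map (CommRingCat.ofHom
      (algebraMap k (MvPolynomial.homogeneousSubmodule (Fin (N + 1)) k 0)))

instance (k : Type u) [Field k] (N : ℕ) : QuasiCompact (ProjectiveSpaceOver.str k N) := by
  have : IsScalarTower k (MvPolynomial.homogeneousSubmodule (Fin (N + 1)) k 0)
      (MvPolynomial (Fin (N + 1)) k) := ⟨fun _ _ _ ↦ smul_mul_assoc _ _ _⟩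
  have : Algebra.FiniteType (MvPolynomial.homogeneousSubmodule (Fin (N + 1)) k 0)
      (MvPolynomial (Fin (N + 1)) k) := .of_restrictScalars_finiteType k _ _
  unfold ProjectiveSpaceOver.str
  infer_instance

/-- A smooth projective curve over a field `k`: an integral scheme which is smooth of relative
dimension one over `k` and admits a closed `k`-immersion into some projective space over `k`.
(A scheme smooth over a field is integral if and only if it is connected and nonempty. It need
not be geometrically connected.) -/
structure SmoothProjectiveCurve (k : Type u) [Field k] where
  /-- The underlying scheme. -/
  X : Scheme.{u}
  /-- The structure morphism. -/
  str : X ⟶ Spec (.of k)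
  [isIntegral : IsIntegral X]
  [smooth : SmoothOfRelativeDimension 1 str]
  projective : ∃ (N : ℕ) (i : X ⟶ ProjectiveSpaceOver k N),
    IsClosedImmersion i ∧ i ≫ ProjectiveSpaceOver.str k N = str

end Curve

namespace SmoothProjectiveCurve

attribute [instance] isIntegral smooth

variable {k : Type u} [Field k] (C : SmoothProjectiveCurve k)

instance : NoetherianSpace C.X := by
  have := SmoothOfRelativeDimension.smooth 1 C.str
  have : LocallyOfFiniteType C.str := inferInstance
  have : QuasiCompact C.str := by
    obtain ⟨N, i, hi, h⟩ := C.projective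
    rw [← h]
    infer_instance
  have : CompactSpace C.X := QuasiCompact.compactSpace_of_compactSpace C.str
  have : IsLocallyNoetherian C.X := LocallyOfFiniteType.isLocallyNoetherian C.str
  have : IsNoetherian C.X := {}
  infer_instance

/-! ### Adèles

The function field `F` of `C` is `C.X.functionField`, the stalk at the generic point. -/

/-- The closed points of the curve. -/
abbrev Place : Type u := {x : C.X // IsClosed ({x} : Set C.X)}

instance (x : C.Place) : IsDiscreteValuationRing (C.X.presheaf.stalk x.1) :=
  stalk_isDVR C.str x.1 x.2

/-- The maximal ideal of the local ring at a closed point, as a place of the function field. -/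
noncomputable abbrev maxIdeal (x : C.Place) :
    IsDedekindDomain.HeightOneSpectrum (C.X.presheaf.stalk x.1) :=
  IsDiscreteValuationRing.maximalIdeal (C.X.presheaf.stalk x.1)

/-- The completion `F_x` of the function field at the closed point `x`. -/
abbrev LocalField (x : C.Place) : Type u :=
  (C.maxIdeal x).adicCompletion C.X.functionField

/-- The ring of integers `𝒪_x` of `F_x`. -/
noncomputable abbrev localIntegers (x : C.Place) : ValuationSubring (C.LocalField x) :=
  (C.maxIdeal x).adicCompletionIntegers C.X.functionField

/-- The ring of adèles `𝔸`: the restricted product over all closed points `x` of the fields `F_x`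
with respect to the subrings `𝒪_x`. -/
abbrev Adeles : Type u := Πʳ x : C.Place, [C.LocalField x, C.localIntegers x]

/-- The ring of integral adèles `𝒪 = ∏ₓ 𝒪_x`. -/
abbrev IntegralAdeles : Type u := Π x : C.Place, C.localIntegers x

theorem finite_poles (a : C.X.functionField) :
    ∀ᶠ x : C.Place in Filter.cofinite,
      algebraMap C.X.functionField (C.LocalField x) a ∈ C.localIntegers x := by
  obtain ⟨U, hU, s, rfl⟩ := C.X.presheaf.exists_germ_eq a
  have hfin := finite_compl_of_genericPoint_mem (fun x hx ↦ stalk_isDVR C.str x hx) U hU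
  refine (hfin.preimage (Subtype.val_injective (p := fun x : C.X ↦ IsClosed {x})).injOn).subset ?_
  intro x hx hxU
  apply hx
  have : Nonempty U := ⟨⟨_, hU⟩⟩
  have := C.X.algebraMap_germ_eq_germToFunctionField hxU s
  change algebraMap C.X.functionField (C.LocalField x) (C.X.germToFunctionField U s) ∈
    C.localIntegers x
  rw [← this]
  exact IsDedekindDomain.HeightOneSpectrum.coe_algebraMap_mem _ _ _ _

/-- The diagonal embedding `F → 𝔸`. -/
noncomputable def diagonal : C.X.functionField →+* C.Adeles where
  toFun a := ⟨fun x ↦ algebraMap C.X.functionField (C.LocalField x) a, C.finite_poles a⟩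
  map_one' := by ext x; exact map_one _
  map_zero' := by ext x; exact map_zero _
  map_mul' a b := by ext x; exact map_mul _ _ _
  map_add' a b := by ext x; exact map_add _ _ _

/-- The inclusion `𝒪 → 𝔸`. -/
noncomputable def integralInclusion : C.IntegralAdeles →+* C.Adeles where
  toFun a := RestrictedProduct.structureMap _ _ _ a
  map_one' := rfl
  map_zero' := rfl
  map_mul' _ _ := rfl
  map_add' _ _ := rfl

/-- `GL_n(F)` as a subgroup of `GL_n(𝔸)`. -/
noncomputable def rationalGL (n : ℕ) : Subgroup (GL (Fin n) C.Adeles) :=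
  (Matrix.GeneralLinearGroup.map C.diagonal).range

/-- `GL_n(𝒪)` as a subgroup of `GL_n(𝔸)`. -/
noncomputable def integralGL (n : ℕ) : Subgroup (GL (Fin n) C.Adeles) :=
  (Matrix.GeneralLinearGroup.map C.integralInclusion).range

/-- The double coset space `GL_n(F) \ GL_n(𝔸) / GL_n(𝒪)`. -/
abbrev WeilQuotient (n : ℕ) : Type u :=
  DoubleCoset.Quotient (C.rationalGL n : Set (GL (Fin n) C.Adeles)) (C.integralGL n)

/-! ### Vector bundles -/

/-- An `𝒪_X`-module is a vector bundle of rank `n` if every point has an open neighbourhood on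
which it is isomorphic to `𝒪ⁿ`. -/
def IsVectorBundle (n : ℕ) : ObjectProperty C.X.Modules := fun M ↦
  ∀ x : C.X, ∃ U : C.X.Opens, x ∈ U ∧
    Nonempty (M.restrict U.ι ≅ (SheafOfModules.free (ULift.{u} (Fin n)) : SheafOfModules _))

/-- The category of vector bundles of rank `n` on the curve. -/
abbrev VectorBundle (n : ℕ) := (C.IsVectorBundle n).FullSubcategory

/-- The set of isomorphism classes of vector bundles of rank `n` on the curve. -/
abbrev VectorBundleClass (n : ℕ) := Quotient (isIsomorphicSetoid (C.VectorBundle n))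

/-! ### Trivializations and transition matrices -/

variable {C}

/-- An `𝒪_X`-module as a presheaf of modules over the presheaf of commutative rings `𝒪_X`. -/
def toPresheafOfModules (M : C.X.Modules) :
    PresheafOfModules (C.X.presheaf ⋙ forget₂ CommRingCat RingCat) := M.val

/-- The stalk of an `𝒪_X`-module. -/
noncomputable abbrev stalk (M : C.X.Modules) (x : C.X) : Ab := M.presheaf.stalk x

noncomputable instance stalkModule (M : C.X.Modules) (x : C.X) :
    Module (C.X.presheaf.stalk x) (stalk M x) :=
  inferInstanceAs (Module (C.X.presheaf.stalk x)
    ↑(TopCat.Presheaf.stalk (toPresheafOfModules M).presheaf x))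

theorem germ_smul_stalk (M : C.X.Modules) (x : C.X) (U : C.X.Opens) (hx : x ∈ U)
    (r : Γ(C.X, U)) (m : Γ(M, U)) :
    (M.presheaf.germ U x hx (r • m) : stalk M x) =
      C.X.presheaf.germ U x hx r • (M.presheaf.germ U x hx m : stalk M x) :=
  PresheafOfModules.germ_smul (toPresheafOfModules M) x U hx r m

/-- The specialization map from the stalk at a point to the stalk at the generic point. -/
noncomputable def specialization (M : C.X.Modules) (x : C.X) :
    stalk M x →+ stalk M (genericPoint C.X) :=
  (M.presheaf.stalkSpecializes ((genericPoint_spec C.X).specializes trivial)).hom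

theorem specialization_smul (M : C.X.Modules) (x : C.X) (r : C.X.presheaf.stalk x)
    (m : stalk M x) : specialization M x (r • m) =
      algebraMap (C.X.presheaf.stalk x) C.X.functionField r • specialization M x m := by
  obtain ⟨U, hU, s, rfl⟩ := C.X.presheaf.exists_germ_eq r
  obtain ⟨V, hVU, hV, t, rfl⟩ := M.presheaf.exists_le_germ_eq m hU
  have hη : genericPoint C.X ∈ V := ((genericPoint_spec C.X).specializes trivial).mem_open V.2 hV
  rw [← C.X.presheaf.germ_res_apply (homOfLE hVU) x hV s, ← germ_smul_stalk]
  have h1 (t : Γ(M, V)) : specialization M x (M.presheaf.germ V x hV t) =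
      M.presheaf.germ V (genericPoint C.X) hη t :=
    ConcreteCategory.congr_hom
      (M.presheaf.germ_stalkSpecializes hV ((genericPoint_spec C.X).specializes trivial)) t
  have h2 (t : Γ(C.X, V)) : algebraMap (C.X.presheaf.stalk x) C.X.functionField
      (C.X.presheaf.germ V x hV t) = C.X.presheaf.germ V (genericPoint C.X) hη t :=
    ConcreteCategory.congr_hom
      (C.X.presheaf.germ_stalkSpecializes hV ((genericPoint_spec C.X).specializes trivial)) t
  rw [h1, h1, h2, germ_smul_stalk]

/-- The sections of `M` on the formal disc at `x`: the module `𝒪_x ⊗ M_x` over `𝒪_x`. -/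
abbrev CompletedStalk (M : C.X.Modules) (x : C.Place) : Type u :=
  C.localIntegers x ⊗[C.X.presheaf.stalk x.1] stalk M x.1

/-- The restriction of sections of `M` on the formal disc at `x` to the punctured formal disc:
the map `𝒪_x ⊗ M_x → F_x ⊗_F M_η`, `a ⊗ m ↦ a ⊗ m`, where `η` is the generic point. -/
noncomputable def comparison (M : C.X.Modules) (x : C.Place) :
    CompletedStalk M x →+
      C.LocalField x ⊗[C.X.functionField] stalk M (genericPoint C.X) :=
  TensorProduct.liftAddHom
    { toFun a :=
        { toFun m := (a : C.LocalField x) ⊗ₜ specialization M x.1 m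
          map_zero' := by simp
          map_add' _ _ := by simp [TensorProduct.tmul_add] }
      map_zero' := by ext m; simp
      map_add' _ _ := by ext m; simp [TensorProduct.add_tmul] }
    (fun r a m ↦ by
      have h : ((r • a : C.localIntegers x) : C.LocalField x) =
          algebraMap (C.X.presheaf.stalk x.1) C.X.functionField r • (a : C.LocalField x) :=
        (algebraMap_smul _ r (a : C.LocalField x)).symm
      change ((r • a : C.localIntegers x) : C.LocalField x) ⊗ₜ[C.X.functionField]
        specialization M x.1 m = (a : C.LocalField x) ⊗ₜ specialization M x.1 (r • m)
      rw [h, specialization_smul, TensorProduct.smul_tmul])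

/-- A trivialization of a vector bundle `V` at the generic point (equivalently, on the complement
of some finite set of closed points, up to shrinking) and on the formal disc at every closed
point. -/
structure Trivialization {n : ℕ} (V : C.VectorBundle n) where
  /-- A basis of the generic stalk over the function field. -/
  generic : Module.Basis (Fin n) C.X.functionField (stalk V.obj (genericPoint C.X))
  /-- A basis of the completed stalk at every closed point. -/
  formal (x : C.Place) : Module.Basis (Fin n) (C.localIntegers x) (CompletedStalk V.obj x)

/-- The adelic matrix `g = (g_x)` is the family of transition matrices of a trivialization: on
every punctured formal disc the formal frame `f` and the generic frame `e` are related by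
`f_j = ∑ᵢ (g_x)ᵢⱼ eᵢ`. -/
def Trivialization.IsTransition {n : ℕ} {V : C.VectorBundle n} (t : Trivialization V)
    (g : GL (Fin n) C.Adeles) : Prop :=
  ∀ (x : C.Place) (j : Fin n), comparison V.obj x (t.formal x j) =
    ∑ i, (g.val i j x) ⊗ₜ t.generic i

end SmoothProjectiveCurve

/-! Everything takes place inside `F^n`. A matrix `g` in `GL_n(𝔸)` defines the sheaf whose sections
over `U` are the vectors of `F^n` lying in `g_x 𝒪_x^n` for every closed point `x` of `U`
(`adelicModule`). The proof shows that this sheaf is a vector bundle, and that a bundle `V` is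
isomorphic to it exactly when `g` is a transition matrix of `V` (`mk_adelicBundle_eq_iff`).

Local freeness is an approximation argument. `F` is dense in `F_x` and `GL_n(𝒪_x)` is open, so some
`h` in `GL_n(F)` satisfies `g_x⁻¹ h ∈ GL_n(𝒪_x)` (`exists_functionFieldGL_eq`). As `g⁻¹ h` is
adelic, the same holds at all but finitely many closed points, hence on a neighbourhood of `x`.
There the columns of `h` form a frame (`isFrame_columnSection`), because an element of `F` integral
at every closed point of an open set is regular on it (`exists_regular`).

Conversely, coordinates with respect to a generic frame embed the sections of `V` in `F^n`. A
generic vector comes from the stalk at `x` if and only if its coordinates lie in `g_x 𝒪_x^n`, since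
`F ∩ 𝒪_x` is the local ring at `x` (`equivFun_mem_lattice_iff`). This identifies `V` with the sheaf
of `g`, so no gluing theorem for formal discs is needed.

Every bundle has a transition matrix (`exists_isTransition`). Changing the generic frame multiplies
it by `GL_n(F)` on the left, and changing the formal frames multiplies it by `GL_n(𝒪)` on the right.
Thus the transition matrices of a bundle form exactly one double coset, and the bijection follows.
-/

namespace SheafOfModules

-- Free sheaves of modules of finite rank

universe v₁ u₁

variable {D : Type u₁} [Category.{v₁} D] {J : GrothendieckTopology D} {R : Sheaf J RingCat.{u}}
  [HasWeakSheafify J AddCommGrpCat.{u}] [J.WEqualsLocallyBijective AddCommGrpCat.{u}]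

/-- The value on an object of the tautological section `i` of a free sheaf of modules. -/
noncomputable def freeElement {I : Type u} (i : I) (X : Dᵒᵖ) : (free (R := R) I).val.obj X :=
  (freeSection (R := R) i).val X

theorem ιFree_app_apply {I : Type u} (i : I) (X : Dᵒᵖ) (c : R.obj.obj X) :
    (ιFree (R := R) i).val.app X c = c • freeElement (R := R) i X := by
  have h1 : freeElement (R := R) i X =
      (ιFree (R := R) i ≫ 𝟙 (free I)).val.app X (1 : R.obj.obj X) := rfl
  rw [h1, Category.comp_id]
  refine Eq.trans (congrArg _ (mul_one c).symm) ?_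
  exact ((ιFree (R := R) i).val.app X).hom.map_smul c (1 : R.obj.obj X)

omit [HasWeakSheafify J AddCommGrpCat.{u}] [J.WEqualsLocallyBijective AddCommGrpCat.{u}] in
theorem sum_val_app_apply {M N : SheafOfModules.{u} R} {ι : Type*} (s : Finset ι) (f : ι → (M ⟶ N))
    (X : Dᵒᵖ) (m : M.val.obj X) :
    (∑ i ∈ s, f i).val.app X m = ∑ i ∈ s, (f i).val.app X m := by
  let φ : (M ⟶ N) →+ (N.val.obj X) :=
    { toFun g := g.val.app X m
      map_zero' := rfl
      map_add' _ _ := rfl }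
  exact map_sum φ f s

-- A finite coproduct in an additive category is a biproduct. The projections `p j` satisfy `ιFree i
-- ≫ p j = δᵢⱼ` and `∑ j, p j ≫ ιFree j = 𝟙`, so the coordinates of `w` are its images under the `p
-- j`. This avoids describing sections of the sheafification.
open Classical in
theorem free_existsUnique {I : Type u} [Fintype I] (X : Dᵒᵖ) (w : (free (R := R) I).val.obj X) :
    ∃! c : I → R.obj.obj X, w = ∑ i, c i • freeElement (R := R) i X := by
  let p (j : I) : free (R := R) I ⟶ unit R :=
    Limits.Cofan.IsColimit.desc (isColimitFreeCofan I) (fun i ↦ if i = j then 𝟙 _ else 0)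
  have hp (i j : I) : ιFree i ≫ p j = if i = j then 𝟙 _ else 0 :=
    Limits.Cofan.IsColimit.fac (isColimitFreeCofan I) _ i
  have hsum : ∑ j, p j ≫ ιFree j = 𝟙 (free (R := R) I) := by
    refine Limits.Cofan.IsColimit.hom_ext (isColimitFreeCofan I) _ _ fun i ↦ ?_
    change ιFree i ≫ _ = ιFree i ≫ 𝟙 _
    rw [Preadditive.comp_sum, Category.comp_id, Finset.sum_eq_single i]
    · rw [← Category.assoc, hp, if_pos rfl, Category.id_comp]
    · intro j _ hj
      rw [← Category.assoc, hp, if_neg (Ne.symm hj), Limits.zero_comp]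
    · simp
  have hp' (i j : I) (c : R.obj.obj X) :
      (p j).val.app X (c • freeElement (R := R) i X) = if i = j then c else 0 := by
    rw [← ιFree_app_apply]
    change (ιFree i ≫ p j).val.app X c = _
    rw [hp]
    split_ifs <;> rfl
  refine ⟨fun i ↦ (p i).val.app X w, ?_, ?_⟩
  · have h := sum_val_app_apply Finset.univ (fun j ↦ p j ≫ ιFree j) X w
    rw [hsum] at h
    exact h.trans (Finset.sum_congr rfl fun i _ ↦ ιFree_app_apply i X _)
  · rintro c rfl
    funext j
    rw [map_sum]
    refine ((Finset.sum_congr rfl fun i _ ↦ hp' i j (c i)).trans ?_).symm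
    exact (Finset.sum_ite_eq' _ _ _).trans (if_pos (Finset.mem_univ j))

theorem freeElement_map {I : Type u} (i : I) {X Y : Dᵒᵖ} (f : X ⟶ Y) :
    (free (R := R) I).val.map f (freeElement i X) = freeElement i Y :=
  (freeSection (R := R) i).property f

theorem freeHomEquiv_symm_app_freeElement {M : SheafOfModules.{u} R} {I : Type u}
    (s : I → M.sections) (i : I) (X : Dᵒᵖ) :
    ((freeHomEquiv M).symm s).val.app X (freeElement i X) = (s i).val X :=
  congrFun (congrArg Subtype.val (sectionsMap_freeHomEquiv_symm_freeSection s i)) X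

end SheafOfModules

/-! ### Frames and local freeness -/

namespace AlgebraicGeometry.Scheme.Modules

variable {X : Scheme.{u}}

/-- A frame of an `𝒪_X`-module over an open subset: a family of sections whose restrictions form
a basis of the module of sections over every smaller open subset. -/
def IsFrame {n : ℕ} {M : X.Modules} {U : X.Opens} (s : Fin n → Γ(M, U)) : Prop :=
  ∀ (W : X.Opens) (i : W ⟶ U) (m : Γ(M, W)),
    ∃! c : Fin n → Γ(X, W), m = ∑ k, c k • M.presheaf.map i.op (s k)

/-- Scalars act on the restricted module through `U.ι.appIso W`, which is an identity morphism.
Linear combinations over `U` can therefore be computed on `X`. -/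
theorem restrict_smul {M : X.Modules} (U : X.Opens) (W : U.toScheme.Opens)
    (r : Γ(U.toScheme, W)) (m : Γ(M.restrict U.ι, W)) :
    r • m = (show Γ(M, U.ι ''ᵁ W) from
      (show Γ(X, U.ι ''ᵁ W) from r) • (show Γ(M, U.ι ''ᵁ W) from m)) := by
  have h : (U.ι.appIso W).inv = 𝟙 _ := by rw [Scheme.Opens.ι_appIso]; rfl
  change (show Γ(M, U.ι ''ᵁ W) from (U.ι.appIso W).inv r • (show Γ(M, U.ι ''ᵁ W) from m)) = _
  rw [h]
  rfl

variable (X) in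
/-- The free `𝒪_X`-module of rank `n`. -/
noncomputable def freeModule (n : ℕ) : X.Modules :=
  (SheafOfModules.free (ULift.{u} (Fin n)) : SheafOfModules _)

variable (X) in
/-- The standard basis of the sections of the free `𝒪_X`-module of rank `n`. -/
noncomputable def freeModuleElement {n : ℕ} (k : Fin n) (W : X.Opens) : Γ(freeModule X n, W) :=
  SheafOfModules.freeElement (R := X.ringCatSheaf) (ULift.up.{u} k) (.op W)

theorem freeModule_existsUnique {n : ℕ} {W : X.Opens} (w : Γ(freeModule X n, W)) :
    ∃! c : Fin n → Γ(X, W), w = ∑ k, c k • freeModuleElement X k W := by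
  obtain ⟨c, hc, hu⟩ := SheafOfModules.free_existsUnique (R := X.ringCatSheaf)
    (I := ULift.{u} (Fin n)) (.op W) w
  refine ⟨fun k ↦ c (.up k), ?_, fun c' hc' ↦ ?_⟩
  · exact hc.trans (Fintype.sum_equiv Equiv.ulift _ _ fun _ ↦ rfl)
  · have := hu (fun k ↦ c' k.down)
      (hc'.trans (Fintype.sum_equiv Equiv.ulift.symm _ _ fun _ ↦ rfl))
    rw [← this]

theorem freeModuleElement_map {n : ℕ} (k : Fin n) {V W : X.Opens} (i : V ⟶ W) :
    (freeModule X n).presheaf.map i.op (freeModuleElement X k W) = freeModuleElement X k V :=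
  SheafOfModules.freeElement_map _ i.op

theorem exists_freeModule_hom {n : ℕ} {M : X.Modules} (s : Fin n → Γ(M, ⊤)) :
    ∃ φ : freeModule X n ⟶ M, ∀ k W, φ.app W (freeModuleElement X k W) =
      M.presheaf.map (homOfLE le_top).op (s k) := by
  let σ (k : ULift.{u} (Fin n)) : SheafOfModules.sections (R := X.ringCatSheaf) M :=
    ⟨fun W ↦ M.presheaf.map (homOfLE (le_top : W.unop ≤ ⊤)).op (s k.down), fun {V W} f ↦ by
      change M.presheaf.map f (M.presheaf.map _ _) = _
      rw [← ConcreteCategory.comp_apply, ← Functor.map_comp]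
      rfl⟩
  exact ⟨(SheafOfModules.freeHomEquiv (R := X.ringCatSheaf) M).symm σ, fun k W ↦
    SheafOfModules.freeHomEquiv_symm_app_freeElement (R := X.ringCatSheaf) (M := M) σ _ _⟩

theorem Hom.app_map {M N : X.Modules} (φ : M ⟶ N) {V W : X.Opens} (i : V ⟶ W) (m : Γ(M, W)) :
    φ.app V (M.presheaf.map i.op m) = N.presheaf.map i.op (φ.app W m) :=
  PresheafOfModules.naturality_apply φ.val i.op m

theorem presheaf_map_map (M : X.Modules) {U V W : X.Opens} (i : U ⟶ V) (j : V ⟶ W) (l : U ⟶ W)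
    (m : Γ(M, W)) :
    M.presheaf.map i.op (M.presheaf.map j.op m) = M.presheaf.map l.op m := by
  rw [← ConcreteCategory.comp_apply, ← Functor.map_comp]
  rfl

theorem exists_image_eq {U W : X.Opens} (h : W ≤ U) : ∃ W' : U.toScheme.Opens, U.ι ''ᵁ W' = W :=
  ⟨U.ι ⁻¹ᵁ W, by rw [Scheme.Hom.image_preimage_eq_opensRange_inf]; simpa using h⟩

theorem sum_restrict_smul {M : X.Modules} (U : X.Opens) (W : U.toScheme.Opens) {n : ℕ}
    (c : Fin n → Γ(U.toScheme, W)) (m : Fin n → Γ(M.restrict U.ι, W)) :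
    ∑ k, c k • m k = (∑ k, (show Γ(X, U.ι ''ᵁ W) from c k) • (show Γ(M, U.ι ''ᵁ W) from m k) :
      Γ(M, U.ι ''ᵁ W)) :=
  Finset.sum_congr rfl fun k _ ↦ restrict_smul U W (c k) (m k)

theorem exists_isFrame_of_iso {n : ℕ} {M : X.Modules} {U : X.Opens}
    (e : M.restrict U.ι ≅ freeModule U.toScheme n) :
    ∃ s : Fin n → Γ(M, U), IsFrame s := by
  let σ (k : Fin n) (W : U.toScheme.Opens) : Γ(M.restrict U.ι, W) :=
    e.inv.app W (freeModuleElement _ k W)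
  refine ⟨fun k ↦ M.presheaf.map (eqToHom U.ι_image_top.symm).op
    (show Γ(M, U.ι ''ᵁ ⊤) from σ k ⊤), ?_⟩
  intro W i m
  obtain ⟨W', rfl⟩ := exists_image_eq (leOfHom i)
  have hσ (k : Fin n) : M.presheaf.map i.op (M.presheaf.map (eqToHom U.ι_image_top.symm).op
      (show Γ(M, U.ι ''ᵁ ⊤) from σ k ⊤)) = σ k W' := by
    rw [← ConcreteCategory.comp_apply, ← Functor.map_comp]
    refine Eq.trans ?_ ((Hom.app_map e.inv (homOfLE (le_top : W' ≤ ⊤)) _).symm.trans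
      (congrArg _ (freeModuleElement_map k _)))
    rfl
  simp only [hσ]
  have hinv (w : Γ(M.restrict U.ι, W')) : e.inv.app W' (e.hom.app W' w) = w := by
    rw [← ConcreteCategory.comp_apply, ← Hom.comp_app, e.hom_inv_id]; rfl
  have hinv' (w : Γ(freeModule U.toScheme n, W')) : e.hom.app W' (e.inv.app W' w) = w := by
    rw [← ConcreteCategory.comp_apply, ← Hom.comp_app, e.inv_hom_id]; rfl
  obtain ⟨c, hc, hu⟩ := freeModule_existsUnique (e.hom.app W' (show Γ(M.restrict U.ι, W') from m))
  refine ⟨c, ?_, fun c' hc' ↦ hu c' ?_⟩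
  · refine Eq.trans ?_ (sum_restrict_smul U W' c (fun k ↦ σ k W'))
    refine (hinv m).symm.trans ((congrArg _ hc).trans ?_)
    rw [map_sum]
    exact Finset.sum_congr rfl fun k _ ↦ Hom.app_smul _ _ _
  · refine (congrArg _ (hc'.trans (sum_restrict_smul U W' c' (fun k ↦ σ k W')).symm)).trans ?_
    rw [map_sum]
    refine Finset.sum_congr rfl fun k _ ↦ ?_
    refine (Hom.app_smul e.hom (c' k) (σ k W')).trans ?_
    rw [hinv']

/-- The frame extends to a morphism from the free module. Existence and uniqueness of coordinates
over each smaller open set say that this morphism is bijective on sections there. -/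
theorem IsFrame.nonempty_iso {n : ℕ} {M : X.Modules} {U : X.Opens} {s : Fin n → Γ(M, U)}
    (hs : IsFrame s) : Nonempty (M.restrict U.ι ≅ freeModule U.toScheme n) := by
  obtain ⟨φ, hφ⟩ := exists_freeModule_hom (M := M.restrict U.ι)
    (fun k ↦ M.presheaf.map (eqToHom U.ι_image_top).op (s k))
  have : IsIso φ := by
    rw [Hom.isIso_iff_isIso_app]
    intro W
    have hW : U.ι ''ᵁ W ≤ U := U.ι_image_le W
    have hφ' (k : Fin n) : φ.app W (freeModuleElement _ k W) =
        (show Γ(M, U.ι ''ᵁ W) from M.presheaf.map (homOfLE hW).op (s k)) := by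
      refine (hφ k W).trans ?_
      exact presheaf_map_map M (homOfLE (Scheme.Hom.image_mono _ le_top)) (eqToHom U.ι_image_top)
        (homOfLE hW) (s k)
    have key (c : Fin n → Γ(U.toScheme, W)) :
        φ.app W (∑ k, c k • freeModuleElement _ k W) =
          (∑ k, (show Γ(X, U.ι ''ᵁ W) from c k) • M.presheaf.map (homOfLE hW).op (s k) :
            Γ(M, U.ι ''ᵁ W)) := by
      rw [map_sum]
      refine Finset.sum_congr rfl fun k _ ↦ ?_
      exact (Hom.app_smul φ (c k) _).trans ((congrArg (c k • ·) (hφ' k)).trans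
        (restrict_smul U W _ _))
    rw [ConcreteCategory.isIso_iff_bijective]
    constructor
    · intro w w' h
      obtain ⟨c, rfl, -⟩ := freeModule_existsUnique w
      obtain ⟨c', rfl, -⟩ := freeModule_existsUnique w'
      rw [key, key] at h
      obtain rfl : c = c' := (hs _ (homOfLE hW) _).unique rfl h
      rfl
    · intro m
      obtain ⟨c, hc, -⟩ := hs _ (homOfLE hW) m
      exact ⟨∑ k, (show Γ(U.toScheme, W) from c k) • freeModuleElement _ k W,
        (key c).trans hc.symm⟩
  exact ⟨(asIso φ).symm⟩

end AlgebraicGeometry.Scheme.Modules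

namespace SmoothProjectiveCurve

open AlgebraicGeometry.Scheme.Modules

variable {k : Type u} [Field k] {C : SmoothProjectiveCurve k} {n : ℕ}

theorem isVectorBundle_iff (M : C.X.Modules) : C.IsVectorBundle n M ↔
    ∀ x : C.X, ∃ U : C.X.Opens, x ∈ U ∧ ∃ s : Fin n → Γ(M, U), IsFrame s :=
  forall_congr' fun _ ↦ exists_congr fun _ ↦ and_congr_right fun _ ↦
    ⟨fun ⟨e⟩ ↦ exists_isFrame_of_iso e, fun ⟨_, hs⟩ ↦ hs.nonempty_iso⟩

end SmoothProjectiveCurve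

namespace AlgebraicGeometry.Scheme.Modules

variable {X : Scheme.{u}}

theorem IsFrame.map {n : ℕ} {M : X.Modules} {U V : X.Opens} {s : Fin n → Γ(M, U)}
    (hs : IsFrame s) (i : V ⟶ U) : IsFrame fun k ↦ M.presheaf.map i.op (s k) := by
  intro W j m
  simpa only [presheaf_map_map M j i (j ≫ i)] using hs W (j ≫ i) m

theorem exists_germ_eq_family {ι : Type*} [Finite ι] {x : X} (r : ι → X.presheaf.stalk x)
    {U : X.Opens} (hU : x ∈ U) : ∃ V ≤ U, ∃ (hV : x ∈ V) (ρ : ι → Γ(X, V)),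
      ∀ i, X.presheaf.germ V x hV (ρ i) = r i := by
  have := Fintype.ofFinite ι
  choose V hVU hV ρ hρ using fun i ↦ X.presheaf.exists_le_germ_eq (r i) hU
  have hx : x ∈ U ⊓ Finset.univ.inf V := by
    refine ⟨hU, ?_⟩
    simpa [Opens.coe_finset_inf] using hV
  have hle (i : ι) : U ⊓ Finset.univ.inf V ≤ V i :=
    inf_le_right.trans (Finset.inf_le (Finset.mem_univ i))
  refine ⟨_, inf_le_left, hx, fun i ↦ X.presheaf.map (homOfLE (hle i)).op (ρ i), fun i ↦ ?_⟩
  rw [X.presheaf.germ_res_apply, hρ]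

end AlgebraicGeometry.Scheme.Modules

/-! ### Stalk bases, germs at the generic point and gluing -/

namespace SmoothProjectiveCurve

open AlgebraicGeometry.Scheme.Modules

variable {k : Type u} [Field k] {C : SmoothProjectiveCurve k} {n : ℕ}

theorem genericPoint_mem {U : C.X.Opens} {x : C.X} (hx : x ∈ U) : genericPoint C.X ∈ U :=
  ((genericPoint_spec C.X).specializes trivial).mem_open U.2 hx

theorem germ_map_apply (M : C.X.Modules) {U V : C.X.Opens} (i : V ⟶ U) {x : C.X} (hx : x ∈ V)
    (m : Γ(M, U)) : (M.presheaf.germ V x hx (M.presheaf.map i.op m) : stalk M x) =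
      M.presheaf.germ U x (leOfHom i hx) m :=
  M.presheaf.germ_res_apply i x hx m

theorem specialization_germ (M : C.X.Modules) {U : C.X.Opens} {x : C.X} (hx : x ∈ U)
    (m : Γ(M, U)) : specialization M x (M.presheaf.germ U x hx m) =
      M.presheaf.germ U (genericPoint C.X) (genericPoint_mem hx) m :=
  ConcreteCategory.congr_hom
    (M.presheaf.germ_stalkSpecializes hx ((genericPoint_spec C.X).specializes trivial)) m

theorem algebraMap_germ {U : C.X.Opens} {x : C.X} (hx : x ∈ U) (r : Γ(C.X, U)) :
    algebraMap (C.X.presheaf.stalk x) C.X.functionField (C.X.presheaf.germ U x hx r) =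
      C.X.presheaf.germ U (genericPoint C.X) (genericPoint_mem hx) r :=
  ConcreteCategory.congr_hom
    (C.X.presheaf.germ_stalkSpecializes hx ((genericPoint_spec C.X).specializes trivial)) r

theorem germ_sum_smul (M : C.X.Modules) {U : C.X.Opens} {x : C.X} (hx : x ∈ U)
    (c : Fin n → Γ(C.X, U)) (m : Fin n → Γ(M, U)) :
    (M.presheaf.germ U x hx (∑ i, c i • m i) : stalk M x) =
      ∑ i, C.X.presheaf.germ U x hx (c i) • (M.presheaf.germ U x hx (m i) : stalk M x) := by
  rw [map_sum]
  exact Finset.sum_congr rfl fun i _ ↦ germ_smul_stalk M x U hx (c i) (m i)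

/-- A linear relation between germs already holds between sections on some neighbourhood, where
uniqueness of coordinates makes it trivial. Likewise every germ is represented by a section that the
frame spans. -/
theorem IsFrame.exists_stalk_basis {M : C.X.Modules} {U : C.X.Opens} {s : Fin n → Γ(M, U)}
    (hs : IsFrame s) {x : C.X} (hx : x ∈ U) :
    ∃ b : Module.Basis (Fin n) (C.X.presheaf.stalk x) (stalk M x),
      ∀ i, b i = M.presheaf.germ U x hx (s i) := by
  let v (i : Fin n) : stalk M x := M.presheaf.germ U x hx (s i)
  have hli : LinearIndependent (C.X.presheaf.stalk x) v := by
    rw [Fintype.linearIndependent_iff]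
    intro r hr
    obtain ⟨V, hVU, hV, ρ, hρ⟩ := exists_germ_eq_family r hx
    have h : M.presheaf.germ V x hV (∑ i, ρ i • M.presheaf.map (homOfLE hVU).op (s i)) =
        M.presheaf.germ V x hV 0 := by
      rw [map_zero, germ_sum_smul]
      simpa only [germ_map_apply, hρ] using hr
    obtain ⟨W, hW, iV, iV', h⟩ := M.presheaf.germ_eq x hV hV _ _ h
    rw [map_zero, map_sum] at h
    have h0 : ∃! c : Fin n → Γ(C.X, W), (0 : Γ(M, W)) = _ := hs W (iV ≫ homOfLE hVU) 0
    have h1 : (fun i ↦ C.X.presheaf.map iV.op (ρ i)) = 0 := by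
      refine h0.unique ?_ (by simp)
      rw [← h]
      refine Finset.sum_congr rfl fun i _ ↦ ?_
      rw [map_smul, presheaf_map_map M iV (homOfLE hVU) (iV ≫ homOfLE hVU)]
    intro i
    rw [← hρ, ← C.X.presheaf.germ_res_apply iV x hW, show C.X.presheaf.map iV.op (ρ i) = 0 from
      congrFun h1 i, map_zero]
  have hsp : ⊤ ≤ Submodule.span (C.X.presheaf.stalk x) (Set.range v) := by
    rintro m -
    obtain ⟨V, hVU, hV, t, rfl⟩ := M.presheaf.exists_le_germ_eq m hx
    obtain ⟨c, rfl, -⟩ := hs V (homOfLE hVU) t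
    rw [germ_sum_smul]
    refine Submodule.sum_mem _ fun i _ ↦ Submodule.smul_mem _ _ (Submodule.subset_span ⟨i, ?_⟩)
    exact (germ_map_apply M _ hV (s i)).symm
  exact ⟨.mk hli hsp, fun i ↦ Module.Basis.mk_apply hli hsp i⟩

theorem germ_genericPoint_injective {U : C.X.Opens} (hU : genericPoint C.X ∈ U) :
    Function.Injective (C.X.presheaf.germ U (genericPoint C.X) hU) := by
  have : Nonempty U := ⟨⟨_, hU⟩⟩
  exact germ_injective_of_isIntegral C.X _ hU

/-- A section of a vector bundle whose germ at the generic point vanishes is zero. -/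
theorem eq_of_germ_genericPoint_eq {M : C.X.Modules} (hM : C.IsVectorBundle n M)
    {W : C.X.Opens} (m m' : Γ(M, W)) (h : ∀ hW : genericPoint C.X ∈ W,
      M.presheaf.germ W (genericPoint C.X) hW m = M.presheaf.germ W (genericPoint C.X) hW m') :
    m = m' := by
  choose U hU s hs using (isVectorBundle_iff M).mp hM
  refine TopCat.Sheaf.eq_of_locally_eq' ⟨M.presheaf, M.isSheaf⟩ (fun x : W ↦ W ⊓ U x) W
    (fun x ↦ homOfLE inf_le_left) (fun x hx ↦ ?_) m m' fun x ↦ ?_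
  · exact Opens.mem_iSup.mpr ⟨⟨x, hx⟩, hx, hU x⟩
  · have hη : genericPoint C.X ∈ W ⊓ U x := genericPoint_mem ⟨x.2, hU x⟩
    obtain ⟨c, hc, -⟩ := hs x _ (homOfLE inf_le_right)
      (M.presheaf.map (homOfLE (inf_le_left : W ⊓ U x ≤ W)).op m)
    obtain ⟨c', hc', -⟩ := hs x _ (homOfLE inf_le_right)
      (M.presheaf.map (homOfLE (inf_le_left : W ⊓ U x ≤ W)).op m')
    obtain ⟨b, hb⟩ := IsFrame.exists_stalk_basis (hs x) hη.2
    have h1 := h hη.1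
    rw [← germ_map_apply M (homOfLE (inf_le_left : W ⊓ U x ≤ W)) hη,
      ← germ_map_apply M (homOfLE (inf_le_left : W ⊓ U x ≤ W)) hη, hc, hc',
      germ_sum_smul, germ_sum_smul] at h1
    simp only [germ_map_apply, ← hb] at h1
    -- The germs of the frame form a basis of the generic stalk, so the coordinates agree there; a
    -- regular function is determined by its generic germ because the curve is integral.
    have h2 : c = c' := by
      funext i
      apply germ_genericPoint_injective hη
      have := congrArg (fun z ↦ b.repr z i) h1
      simpa [Finsupp.single_apply] using this
    change M.presheaf.map (homOfLE (inf_le_left : W ⊓ U x ≤ W)).op m =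
      M.presheaf.map (homOfLE (inf_le_left : W ⊓ U x ≤ W)).op m'
    rw [hc, hc', h2]

/-- Local sections with a common generic germ agree on overlaps by `eq_of_germ_genericPoint_eq`, so
they glue. -/
theorem exists_section_of_locally {M : C.X.Modules} (hM : C.IsVectorBundle n M)
    {W : C.X.Opens} (v : stalk M (genericPoint C.X))
    (h : ∀ x ∈ W, ∃ (V : C.X.Opens) (hV : x ∈ V) (m : Γ(M, V)),
      M.presheaf.germ V (genericPoint C.X) (genericPoint_mem hV) m = v) :
    ∃ m : Γ(M, W), ∀ hW : genericPoint C.X ∈ W,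
      M.presheaf.germ W (genericPoint C.X) hW m = v := by
  choose V hV m hm using fun x : W ↦ h x x.2
  obtain ⟨t, ht, -⟩ := TopCat.Sheaf.existsUnique_gluing' ⟨M.presheaf, M.isSheaf⟩
    (fun x : W ↦ W ⊓ V x) W (fun x ↦ homOfLE inf_le_left)
    (fun x hx ↦ Opens.mem_iSup.mpr ⟨⟨x, hx⟩, hx, hV ⟨x, hx⟩⟩)
    (fun x ↦ M.presheaf.map (homOfLE (inf_le_right : W ⊓ V x ≤ V x)).op (m x)) (fun x y ↦ by
      refine eq_of_germ_genericPoint_eq hM _ _ fun hη ↦ ?_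
      refine (germ_map_apply M (Opens.infLELeft _ _) hη _).trans
        (Eq.trans ?_ (germ_map_apply M (Opens.infLERight _ _) hη _).symm)
      rw [germ_map_apply, germ_map_apply, hm, hm])
  refine ⟨t, fun hW ↦ ?_⟩
  let x : W := ⟨_, hW⟩
  rw [← hm x, ← germ_map_apply M (homOfLE (inf_le_right : W ⊓ V x ≤ V x)) ⟨hW, hV x⟩,
    ← germ_map_apply M (homOfLE (inf_le_left : W ⊓ V x ≤ W)) ⟨hW, hV x⟩]
  exact congrArg _ (ht x)

theorem exists_regular_of_locally {W : C.X.Opens} (a : C.X.functionField)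
    (h : ∀ x ∈ W, ∃ (V : C.X.Opens) (hV : x ∈ V) (r : Γ(C.X, V)),
      C.X.presheaf.germ V (genericPoint C.X) (genericPoint_mem hV) r = a) :
    ∃ r : Γ(C.X, W), ∀ hW : genericPoint C.X ∈ W,
      C.X.presheaf.germ W (genericPoint C.X) hW r = a := by
  choose V hV m hm using fun x : W ↦ h x x.2
  obtain ⟨t, ht⟩ : ∃ t : Γ(C.X, W), ∀ x : W, C.X.presheaf.map
      (homOfLE (inf_le_left : W ⊓ V x ≤ W)).op t =
      C.X.presheaf.map (homOfLE (inf_le_right : W ⊓ V x ≤ V x)).op (m x) := by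
    refine (TopCat.Sheaf.existsUnique_gluing' ⟨C.X.presheaf, C.X.IsSheaf⟩
    (fun x : W ↦ W ⊓ V x) W (fun x ↦ homOfLE inf_le_left)
    (fun x hx ↦ Opens.mem_iSup.mpr ⟨⟨x, hx⟩, hx, hV ⟨x, hx⟩⟩)
    (fun x ↦ C.X.presheaf.map (homOfLE (inf_le_right : W ⊓ V x ≤ V x)).op (m x)) (fun x y ↦ ?_)).exists
    · have hη : genericPoint C.X ∈ (W ⊓ V x) ⊓ (W ⊓ V y) :=
        genericPoint_mem (x := genericPoint C.X)
          ⟨⟨genericPoint_mem x.2, genericPoint_mem (hV x)⟩,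
            genericPoint_mem x.2, genericPoint_mem (hV y)⟩
      apply germ_genericPoint_injective hη
      refine (C.X.presheaf.germ_res_apply (Opens.infLELeft _ _) _ hη _).trans
        (Eq.trans ?_ (C.X.presheaf.germ_res_apply (Opens.infLERight _ _) _ hη _).symm)
      rw [C.X.presheaf.germ_res_apply, C.X.presheaf.germ_res_apply, hm, hm]
  refine ⟨t, fun hW ↦ ?_⟩
  let x : W := ⟨_, hW⟩
  rw [← hm x, ← C.X.presheaf.germ_res_apply (homOfLE (inf_le_right : W ⊓ V x ≤ V x)) _ ⟨hW, hV x⟩,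
    ← C.X.presheaf.germ_res_apply (homOfLE (inf_le_left : W ⊓ V x ≤ W)) _ ⟨hW, hV x⟩]
  exact congrArg _ (ht x)

/-! ### Integrality at the places of the curve -/

/-- An element of the function field is regular at a closed point if it is integral there. -/
theorem mem_range_of_mem_localIntegers {x : C.Place} {a : C.X.functionField}
    (ha : algebraMap C.X.functionField (C.LocalField x) a ∈ C.localIntegers x) :
    a ∈ (algebraMap (C.X.presheaf.stalk x.1) C.X.functionField).range := by
  refine IsDedekindDomain.HeightOneSpectrum.mem_integers_of_valuation_le_one _ a fun v ↦ ?_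
  -- A discrete valuation ring has only one nonzero prime, so integrality at all height-one primes
  -- is integrality at `x`.
  have hv : v = C.maxIdeal x := by
    ext1
    exact IsLocalRing.eq_maximalIdeal (v.isPrime.isMaximal v.ne_bot)
  rw [hv, ← IsDedekindDomain.HeightOneSpectrum.valuedAdicCompletion_eq_valuation']
  exact ha

theorem isClosed_or_eq_genericPoint (x : C.X) : IsClosed {x} ∨ x = genericPoint C.X :=
  or_iff_not_imp_right.mpr
    (isClosed_of_ne_genericPoint (fun x hx ↦ stalk_isDVR C.str x hx) x)

/-- An element of the function field which is integral at all closed points of an open subset is a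
regular function on this subset. -/
theorem exists_regular {W : C.X.Opens} (a : C.X.functionField)
    (h : ∀ x : C.Place, x.1 ∈ W →
      algebraMap C.X.functionField (C.LocalField x) a ∈ C.localIntegers x) :
    ∃ r : Γ(C.X, W), ∀ hW : genericPoint C.X ∈ W,
      C.X.presheaf.germ W (genericPoint C.X) hW r = a := by
  refine exists_regular_of_locally a fun x hx ↦ ?_
  obtain hc | rfl := isClosed_or_eq_genericPoint x
  · obtain ⟨b, rfl⟩ := mem_range_of_mem_localIntegers (h ⟨x, hc⟩ hx)
    obtain ⟨V, hV, r, rfl⟩ := C.X.presheaf.exists_germ_eq b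
    exact ⟨V, hV, r, (algebraMap_germ hV r).symm⟩
  · obtain ⟨V, hV, r, rfl⟩ := C.X.presheaf.exists_germ_eq a
    exact ⟨V, hV, r, rfl⟩

theorem algebraMap_stalk_mem (x : C.Place) (r : C.X.presheaf.stalk x.1) :
    algebraMap C.X.functionField (C.LocalField x)
      (algebraMap (C.X.presheaf.stalk x.1) C.X.functionField r) ∈ C.localIntegers x :=
  IsDedekindDomain.HeightOneSpectrum.coe_algebraMap_mem _ _ _ _

/-- The complement of a finite set of closed points. -/
def complOfFinite {S : Set C.Place} (hS : S.Finite) : C.X.Opens where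
  carrier := {x | ∀ y ∈ S, x ≠ y.1}
  is_open' := by
    have : {x : C.X | ∀ y ∈ S, x ≠ y.1} = ⋂ y ∈ S, {y.1}ᶜ := by ext; simp
    rw [this]
    exact hS.isOpen_biInter fun y _ ↦ y.2.isOpen_compl

/-- The stalk at a closed point is a discrete valuation ring, hence not a field, whereas the generic
stalk is the function field. -/
theorem genericPoint_not_isClosed (C : SmoothProjectiveCurve k) :
    ¬ IsClosed {genericPoint C.X} := by
  intro h
  have := stalk_isDVR C.str _ h
  exact IsDiscreteValuationRing.not_isField (C.X.presheaf.stalk (genericPoint C.X))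
    (Field.toIsField C.X.functionField)

theorem genericPoint_mem_complOfFinite {S : Set C.Place} (hS : S.Finite) :
    genericPoint C.X ∈ complOfFinite hS :=
  fun y _ h ↦ genericPoint_not_isClosed C (h ▸ y.2)

end SmoothProjectiveCurve

/-! ### Change of basis -/

section ChangeOfBasis

variable {ι R M : Type*} [Fintype ι] [DecidableEq ι] [CommRing R] [AddCommGroup M] [Module R M]

omit [DecidableEq ι] in
-- Frames are treated as row vectors: `(e A) B = e (A B)`. This convention places rational changes
-- of frame on the left of `g` and integral ones on the right.
theorem Matrix.sum_smul_sum_smul (A B : Matrix ι ι R) (e : ι → M) (j : ι) :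
    ∑ l, B l j • ∑ i, A i l • e i = ∑ i, (A * B) i j • e i := by
  simp only [Finset.smul_sum, Matrix.mul_apply, Finset.sum_smul, smul_smul]
  rw [Finset.sum_comm]
  simp only [mul_comm]

theorem Module.Basis.exists_eq_sum_smul (b : Module.Basis ι R M) (A : GL ι R) :
    ∃ b' : Module.Basis ι R M, ∀ j, b' j = ∑ i, A.val i j • b i :=
  ⟨b.map (Matrix.toLinearEquiv b A.val ((Matrix.isUnit_iff_isUnit_det _).mp A.isUnit)),
    fun j ↦ by simp [Matrix.toLin_self]⟩

theorem Module.Basis.exists_transition (b b' : Module.Basis ι R M) :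
    ∃ A : GL ι R, ∀ j, b' j = ∑ i, A.val i j • b i :=
  ⟨⟨b.toMatrix b', b'.toMatrix b, b.toMatrix_mul_toMatrix_flip b',
    b'.toMatrix_mul_toMatrix_flip b⟩, fun j ↦ (b.sum_toMatrix_smul_self b' j).symm⟩

end ChangeOfBasis

namespace SmoothProjectiveCurve

open AlgebraicGeometry.Scheme.Modules

variable {k : Type u} [Field k] {C : SmoothProjectiveCurve k} {n : ℕ}

/-! ### Adelic matrices and their local components -/

/-- The component at a closed point of an invertible adelic matrix. -/
noncomputable def localGL (n : ℕ) (x : C.Place) :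
    GL (Fin n) C.Adeles →* GL (Fin n) (C.LocalField x) :=
  Matrix.GeneralLinearGroup.map (RestrictedProduct.evalRingHom _ x)

theorem localGL_apply (g : GL (Fin n) C.Adeles) (x : C.Place) (i j : Fin n) :
    (localGL n x g).val i j = g.val i j x := rfl

theorem adelicMatrix_ext {M M' : Matrix (Fin n) (Fin n) C.Adeles}
    (h : ∀ x, M.map (RestrictedProduct.evalRingHom _ x) =
      M'.map (RestrictedProduct.evalRingHom _ x)) : M = M' :=
  Matrix.ext fun i j ↦ Subtype.ext (funext fun x ↦ congrFun (congrFun (h x) i) j)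

theorem integralAdelicMatrix_ext {M M' : Matrix (Fin n) (Fin n) C.IntegralAdeles}
    (h : ∀ x, M.map (Pi.evalRingHom _ x) = M'.map (Pi.evalRingHom _ x)) : M = M' :=
  Matrix.ext fun i j ↦ funext fun x ↦ congrFun (congrFun (h x) i) j

theorem adelicGL_ext {g g' : GL (Fin n) C.Adeles} (h : ∀ x, localGL n x g = localGL n x g') :
    g = g' :=
  Units.ext (adelicMatrix_ext fun x ↦ congrArg Units.val (h x))

/-- The inclusion of the invertible matrices over the ring of integers at a closed point. -/
noncomputable def integersGL (n : ℕ) (x : C.Place) :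
    GL (Fin n) (C.localIntegers x) →* GL (Fin n) (C.LocalField x) :=
  Matrix.GeneralLinearGroup.map (C.localIntegers x).subtype

/-- The inclusion of the invertible matrices over the function field into those over its
completion at a closed point. -/
noncomputable def functionFieldGL (n : ℕ) (x : C.Place) :
    GL (Fin n) C.X.functionField →* GL (Fin n) (C.LocalField x) :=
  Matrix.GeneralLinearGroup.map (algebraMap C.X.functionField (C.LocalField x))

theorem localGL_map_diagonal (a : GL (Fin n) C.X.functionField) (x : C.Place) :
    localGL n x (Matrix.GeneralLinearGroup.map C.diagonal a) = functionFieldGL n x a := rfl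

theorem mem_range_integersGL {x : C.Place} {A : GL (Fin n) (C.LocalField x)}
    (h : ∀ i j, A.val i j ∈ C.localIntegers x) (h' : ∀ i j, A⁻¹.val i j ∈ C.localIntegers x) :
    A ∈ (integersGL n x).range := by
  have hinj : Function.Injective fun M : Matrix (Fin n) (Fin n) (C.localIntegers x) ↦
      M.map (C.localIntegers x).subtype := Matrix.map_injective Subtype.val_injective
  refine ⟨⟨.of fun i j ↦ ⟨A.val i j, h i j⟩, .of fun i j ↦ ⟨A⁻¹.val i j, h' i j⟩, hinj ?_, hinj ?_⟩,
    rfl⟩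
  · simp only [Matrix.map_mul, Matrix.map_one _ (map_zero _) (map_one _)]
    exact A.mul_inv
  · simp only [Matrix.map_mul, Matrix.map_one _ (map_zero _) (map_one _)]
    exact A.inv_mul

theorem exists_integralGL (b : ∀ x : C.Place, GL (Fin n) (C.localIntegers x)) :
    ∃ β ∈ C.integralGL n, ∀ x, localGL n x β = integersGL n x (b x) := by
  refine ⟨_, ⟨⟨.of fun i j x ↦ (b x).val i j, .of fun i j x ↦ (b x)⁻¹.val i j,
    integralAdelicMatrix_ext fun x ↦ ?_, integralAdelicMatrix_ext fun x ↦ ?_⟩, rfl⟩,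
    fun x ↦ rfl⟩
  · rw [Matrix.map_mul, Matrix.map_one _ (map_zero _) (map_one _)]
    exact (b x).mul_inv
  · rw [Matrix.map_mul, Matrix.map_one _ (map_zero _) (map_one _)]
    exact (b x).inv_mul

theorem exists_localIntegers_of_mem_integralGL {β : GL (Fin n) C.Adeles}
    (hβ : β ∈ C.integralGL n) (x : C.Place) :
    ∃ b : GL (Fin n) (C.localIntegers x), localGL n x β = integersGL n x b := by
  obtain ⟨β, rfl⟩ := hβ
  exact ⟨Matrix.GeneralLinearGroup.map (Pi.evalRingHom _ x) β, rfl⟩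

theorem exists_adelicGL (A : ∀ x : C.Place, GL (Fin n) (C.LocalField x))
    (hA : ∀ᶠ x in Filter.cofinite, A x ∈ (integersGL n x).range) :
    ∃ g : GL (Fin n) C.Adeles, ∀ x, localGL n x g = A x := by
  have h1 (i j : Fin n) : ∀ᶠ x in Filter.cofinite, (A x).val i j ∈ C.localIntegers x := by
    filter_upwards [hA] with x ⟨b, hb⟩
    rw [← hb]
    exact (b.val i j).2
  have h2 (i j : Fin n) : ∀ᶠ x in Filter.cofinite, (A x)⁻¹.val i j ∈ C.localIntegers x := by
    filter_upwards [hA] with x ⟨b, hb⟩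
    rw [← hb, ← map_inv]
    exact (b⁻¹.val i j).2
  refine ⟨⟨.of fun i j ↦ ⟨fun x ↦ (A x).val i j, h1 i j⟩,
    .of fun i j ↦ ⟨fun x ↦ (A x)⁻¹.val i j, h2 i j⟩,
    adelicMatrix_ext fun x ↦ ?_, adelicMatrix_ext fun x ↦ ?_⟩, fun x ↦ rfl⟩
  · rw [Matrix.map_mul, Matrix.map_one _ (map_zero _) (map_one _)]
    exact (A x).mul_inv
  · rw [Matrix.map_mul, Matrix.map_one _ (map_zero _) (map_one _)]
    exact (A x).inv_mul

/-- Integral entries of `g_x` do not suffice; those of `g_x⁻¹` must be integral too. Both fail at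
only finitely many closed points. -/
theorem eventually_mem_range_integersGL (g : GL (Fin n) C.Adeles) :
    ∀ᶠ x in Filter.cofinite, localGL n x g ∈ (integersGL n x).range := by
  have h1 : ∀ᶠ x in Filter.cofinite, ∀ i j, g.val i j x ∈ C.localIntegers x := by
    simp only [Filter.eventually_all]
    exact fun i j ↦ (g.val i j).2
  have h2 : ∀ᶠ x in Filter.cofinite, ∀ i j, g⁻¹.val i j x ∈ C.localIntegers x := by
    simp only [Filter.eventually_all]
    exact fun i j ↦ (g⁻¹.val i j).2
  filter_upwards [h1, h2] with x h1 h2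
  exact mem_range_integersGL h1 h2

/-! ### The comparison map -/

theorem comparison_tmul (M : C.X.Modules) (x : C.Place) (a : C.localIntegers x) (m : stalk M x.1) :
    comparison M x (a ⊗ₜ m) = (a : C.LocalField x) ⊗ₜ specialization M x.1 m := rfl

theorem comparison_smul (M : C.X.Modules) (x : C.Place) (a : C.localIntegers x)
    (z : CompletedStalk M x) :
    comparison M x (a • z) = (a : C.LocalField x) • comparison M x z := by
  induction z using TensorProduct.induction_on with
  | zero => simp
  | tmul b m => simp [TensorProduct.smul_tmul', comparison_tmul]
  | add z w hz hw => rw [smul_add, map_add, hz, hw, map_add, smul_add]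

theorem comparison_sum_smul (M : C.X.Modules) (x : C.Place) (a : Fin n → C.localIntegers x)
    (z : Fin n → CompletedStalk M x) :
    comparison M x (∑ i, a i • z i) = ∑ i, (a i : C.LocalField x) • comparison M x (z i) := by
  simp only [map_sum, comparison_smul]

variable {V : C.VectorBundle n}

theorem Trivialization.isTransition_iff (t : Trivialization V) (g : GL (Fin n) C.Adeles) :
    t.IsTransition g ↔ ∀ (x : C.Place) (j : Fin n), comparison V.obj x (t.formal x j) =
      ∑ i, (localGL n x g).val i j • (1 : C.LocalField x) ⊗ₜ[C.X.functionField] t.generic i := by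
  simp only [IsTransition, TensorProduct.smul_tmul', smul_eq_mul, mul_one, localGL_apply]

theorem tmul_sum_smul {M : Type*} [AddCommGroup M] [Module C.X.functionField M] (x : C.Place)
    (a : Fin n → C.X.functionField) (e : Fin n → M) :
    (1 : C.LocalField x) ⊗ₜ[C.X.functionField] ∑ i, a i • e i =
      ∑ i, algebraMap C.X.functionField (C.LocalField x) (a i) •
        (1 : C.LocalField x) ⊗ₜ[C.X.functionField] e i := by
  simp only [TensorProduct.tmul_sum, TensorProduct.tmul_smul, algebraMap_smul]

/-- Changing the frames of a trivialization changes its transition matrices within a double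
coset. -/
theorem exists_isTransition_of_mk_eq {g g' : GL (Fin n) C.Adeles}
    (h : DoubleCoset.mk (C.rationalGL n) (C.integralGL n) g =
      DoubleCoset.mk (C.rationalGL n) (C.integralGL n) g')
    {t : Trivialization V} (ht : t.IsTransition g) :
    ∃ t' : Trivialization V, t'.IsTransition g' := by
  obtain ⟨_, ⟨a, rfl⟩, β, hβ, rfl⟩ := (DoubleCoset.eq _ _ _ _).mp h
  choose b hb using exists_localIntegers_of_mem_integralGL hβ
  -- Here `g' = a g β`. With the inverse, the old generic frame is `e a`, so the new formal frame is
  -- `(e a) g β = e g'`.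
  obtain ⟨e, he⟩ := t.generic.exists_eq_sum_smul a⁻¹
  choose f hf using fun x ↦ (t.formal x).exists_eq_sum_smul (b x)
  refine ⟨⟨e, f⟩, ?_⟩
  have he' (i : Fin n) : t.generic i = ∑ l, a.val l i • e l := by
    simp only [he]
    rw [Matrix.sum_smul_sum_smul, a.inv_mul]
    simp [Matrix.one_apply]
  rw [Trivialization.isTransition_iff] at ht ⊢
  intro x j
  dsimp only
  rw [hf, comparison_sum_smul]
  simp only [ht, he', tmul_sum_smul]
  have h1 := Matrix.sum_smul_sum_smul (functionFieldGL n x a).val (localGL n x g).val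
    fun i ↦ (1 : C.LocalField x) ⊗ₜ[C.X.functionField] e i
  have h2 := Matrix.sum_smul_sum_smul
    ((functionFieldGL n x a).val * (localGL n x g).val) (integersGL n x (b x)).val
    (fun i ↦ (1 : C.LocalField x) ⊗ₜ[C.X.functionField] e i) j
  rw [map_mul, map_mul, hb, localGL_map_diagonal]
  refine Eq.trans ?_ h2
  simp only [← h1]
  rfl

/-- The transition matrices of two trivializations lie in the same double coset. -/
theorem mk_eq_of_isTransition {g g' : GL (Fin n) C.Adeles} {t t' : Trivialization V}
    (ht : t.IsTransition g) (ht' : t'.IsTransition g') :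
    DoubleCoset.mk (C.rationalGL n) (C.integralGL n) g =
      DoubleCoset.mk (C.rationalGL n) (C.integralGL n) g' := by
  obtain ⟨a, ha⟩ := t.generic.exists_transition t'.generic
  choose b hb using fun x ↦ (t.formal x).exists_transition (t'.formal x)
  obtain ⟨β, hβ, hβ'⟩ := exists_integralGL b
  rw [DoubleCoset.eq]
  -- Expanding the new formal frame in the old generic frame in two ways gives `a g' = g β` at every
  -- closed point.
  refine ⟨_, ⟨a⁻¹, rfl⟩, β, hβ, adelicGL_ext fun x ↦ ?_⟩
  rw [map_mul, map_mul, localGL_map_diagonal, hβ', map_inv, mul_assoc, eq_inv_mul_iff_mul_eq]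
  rw [Trivialization.isTransition_iff] at ht ht'
  have h1 := Matrix.sum_smul_sum_smul (functionFieldGL n x a).val (localGL n x g').val
    fun i ↦ (1 : C.LocalField x) ⊗ₜ[C.X.functionField] t.generic i
  have h2 := Matrix.sum_smul_sum_smul (localGL n x g).val (integersGL n x (b x)).val
    fun i ↦ (1 : C.LocalField x) ⊗ₜ[C.X.functionField] t.generic i
  have h3 (j : Fin n) := ht' x j
  simp only [hb, comparison_sum_smul, ht, ha, tmul_sum_smul] at h3
  refine Units.ext (Matrix.ext fun i j ↦ ?_)
  have h4 := (h1 j).symm.trans ((h3 j).symm.trans (h2 j))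
  have h5 := congrArg (fun z ↦ (t.generic.baseChange (C.LocalField x)).repr z i) h4
  simpa [Finsupp.single_apply, ← Module.Basis.baseChange_apply] using h5

end SmoothProjectiveCurve

namespace AlgebraicGeometry.Scheme.Modules

theorem Hom.congr_app_apply {X : Scheme.{u}} {M N : X.Modules} {φ ψ : M ⟶ N} (h : φ = ψ)
    {U : X.Opens} (m : Γ(M, U)) : φ.app U m = ψ.app U m := by rw [h]

end AlgebraicGeometry.Scheme.Modules

namespace SmoothProjectiveCurve

open AlgebraicGeometry.Scheme.Modules

variable {k : Type u} [Field k] {C : SmoothProjectiveCurve k} {n : ℕ}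

/-! ### Functoriality of trivializations -/

section StalkMap

variable {M N : C.X.Modules}

/-- The map on stalks induced by a morphism of `𝒪_X`-modules. -/
noncomputable def stalkMap (φ : M ⟶ N) (x : C.X) : stalk M x →+ stalk N x :=
  ((TopCat.Presheaf.stalkFunctor Ab x).map φ.mapPresheaf).hom

theorem stalkMap_germ (φ : M ⟶ N) {U : C.X.Opens} {x : C.X} (hx : x ∈ U) (m : Γ(M, U)) :
    stalkMap φ x (M.presheaf.germ U x hx m) = N.presheaf.germ U x hx (φ.app U m) :=
  TopCat.Presheaf.stalkFunctor_map_germ_apply U x hx φ.mapPresheaf m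

theorem stalkMap_smul (φ : M ⟶ N) (x : C.X) (r : C.X.presheaf.stalk x) (m : stalk M x) :
    stalkMap φ x (r • m) = r • stalkMap φ x m := by
  obtain ⟨U, hU, s, rfl⟩ := C.X.presheaf.exists_germ_eq r
  obtain ⟨V, hVU, hV, t, rfl⟩ := M.presheaf.exists_le_germ_eq m hU
  rw [← C.X.presheaf.germ_res_apply (homOfLE hVU) x hV s, ← germ_smul_stalk, stalkMap_germ,
    stalkMap_germ, ← germ_smul_stalk, Hom.app_smul]

theorem specialization_stalkMap (φ : M ⟶ N) (x : C.X) (m : stalk M x) :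
    specialization N x (stalkMap φ x m) = stalkMap φ (genericPoint C.X) (specialization M x m) := by
  obtain ⟨V, hV, t, rfl⟩ := M.presheaf.exists_germ_eq m
  rw [stalkMap_germ, specialization_germ, specialization_germ, stalkMap_germ]

/-- The linear equivalence on stalks induced by an isomorphism of `𝒪_X`-modules. -/
noncomputable def stalkEquiv (e : M ≅ N) (x : C.X) :
    stalk M x ≃ₗ[C.X.presheaf.stalk x] stalk N x where
  toFun := stalkMap e.hom x
  map_add' := map_add _
  map_smul' := stalkMap_smul e.hom x
  invFun := stalkMap e.inv x
  left_inv m := by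
    obtain ⟨V, hV, t, rfl⟩ := M.presheaf.exists_germ_eq m
    rw [stalkMap_germ, stalkMap_germ]
    exact congrArg _ (Hom.congr_app_apply e.hom_inv_id t)
  right_inv m := by
    obtain ⟨V, hV, t, rfl⟩ := N.presheaf.exists_germ_eq m
    rw [stalkMap_germ, stalkMap_germ]
    exact congrArg _ (Hom.congr_app_apply e.inv_hom_id t)

theorem stalkEquiv_apply (e : M ≅ N) (x : C.X) (m : stalk M x) :
    stalkEquiv e x m = stalkMap e.hom x m := rfl

theorem comparison_baseChange (e : M ≅ N) (x : C.Place) (z : CompletedStalk M x) :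
    comparison N x ((stalkEquiv e x.1).baseChange _ (C.localIntegers x) _ _ z) =
      (stalkEquiv e (genericPoint C.X)).baseChange _ (C.LocalField x) _ _ (comparison M x z) := by
  induction z using TensorProduct.induction_on with
  | zero => simp
  | tmul b m =>
    rw [LinearEquiv.baseChange_tmul, comparison_tmul, comparison_tmul, LinearEquiv.baseChange_tmul,
      stalkEquiv_apply, specialization_stalkMap]
    rfl
  | add z w hz hw => rw [map_add, map_add, map_add, map_add, hz, hw]

end StalkMap

theorem Trivialization.exists_isTransition_of_iso {V V' : C.VectorBundle n} (e : V.obj ≅ V'.obj)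
    {g : GL (Fin n) C.Adeles} {t : Trivialization V} (ht : t.IsTransition g) :
    ∃ t' : Trivialization V', t'.IsTransition g := by
  refine ⟨⟨t.generic.map (stalkEquiv e _),
    fun x ↦ (t.formal x).map ((stalkEquiv e x.1).baseChange _ _ _ _)⟩, fun x j ↦ ?_⟩
  simp only [Module.Basis.map_apply]
  rw [comparison_baseChange, ht, map_sum]
  simp only [LinearEquiv.baseChange_tmul]

/-! ### Existence of trivializations -/

theorem IsFrame.exists_formal_basis {M : C.X.Modules} {U : C.X.Opens} {s : Fin n → Γ(M, U)}
    (hs : IsFrame s) {x : C.Place} (hx : x.1 ∈ U) :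
    ∃ f : Module.Basis (Fin n) (C.localIntegers x) (CompletedStalk M x), ∀ j,
      comparison M x (f j) = (1 : C.LocalField x) ⊗ₜ[C.X.functionField]
        (M.presheaf.germ U (genericPoint C.X) (genericPoint_mem hx) (s j) :
          stalk M (genericPoint C.X)) := by
  obtain ⟨b, hb⟩ := IsFrame.exists_stalk_basis hs hx
  refine ⟨b.baseChange _, fun j ↦ ?_⟩
  rw [Module.Basis.baseChange_apply, comparison_tmul, hb, specialization_germ]
  rfl

/-- One frame near the generic point serves both as generic frame and as formal frame at all closed
points of its domain, where the transition matrix is `1`. Only finitely many closed points remain,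
so arbitrary local frames there still give an adelic matrix. -/
theorem exists_isTransition (V : C.VectorBundle n) :
    ∃ (g : GL (Fin n) C.Adeles) (t : Trivialization V), t.IsTransition g := by
  choose U hU s hs using (isVectorBundle_iff V.obj).mp V.property
  obtain ⟨e, he⟩ := IsFrame.exists_stalk_basis (hs (genericPoint C.X)) (hU (genericPoint C.X))
  have key (x : C.Place) : ∃ (f : Module.Basis (Fin n) (C.localIntegers x) (CompletedStalk V.obj x))
      (A : GL (Fin n) (C.LocalField x)), (x.1 ∈ U (genericPoint C.X) → A = 1) ∧
      ∀ j, comparison V.obj x (f j) =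
        ∑ i, A.val i j • (1 : C.LocalField x) ⊗ₜ[C.X.functionField] e i := by
    by_cases hx : x.1 ∈ U (genericPoint C.X)
    · obtain ⟨f, hf⟩ := IsFrame.exists_formal_basis (hs _) hx
      refine ⟨f, 1, fun _ ↦ rfl, fun j ↦ ?_⟩
      simp [hf, he, Matrix.one_apply]
    · obtain ⟨f, hf⟩ := IsFrame.exists_formal_basis (hs x.1) (hU x.1)
      obtain ⟨b, hb⟩ := IsFrame.exists_stalk_basis (hs x.1) (genericPoint_mem (hU x.1))
      obtain ⟨a, ha⟩ := e.exists_transition b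
      refine ⟨f, functionFieldGL n x a, fun h ↦ (hx h).elim, fun j ↦ ?_⟩
      rw [hf, ← hb, ha, tmul_sum_smul]
      rfl
  choose f A hA hf using key
  obtain ⟨g, hg⟩ := exists_adelicGL A (by
    have := finite_compl_of_genericPoint_mem (fun x hx ↦ stalk_isDVR C.str x hx)
      (U (genericPoint C.X)) (hU _)
    refine (this.preimage Subtype.val_injective.injOn).subset fun x hx hxU ↦ hx ?_
    change A x ∈ (integersGL n x).range
    rw [hA x hxU]
    exact one_mem _)
  refine ⟨g, ⟨e, f⟩, (Trivialization.isTransition_iff _ _).mpr fun x j ↦ ?_⟩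
  rw [hg]
  exact hf x j

end SmoothProjectiveCurve

namespace SmoothProjectiveCurve

open AlgebraicGeometry.Scheme.Modules

variable {k : Type u} [Field k] {C : SmoothProjectiveCurve k} {n : ℕ}

/-! ### The vector bundle of an adelic matrix -/

open Matrix in
/-- The lattice in `Fⁿ` of the vectors whose image in `F_xⁿ` lies in `A 𝒪_xⁿ`. -/
def lattice (x : C.Place) (A : GL (Fin n) (C.LocalField x)) :
    Submodule (C.X.presheaf.stalk x.1) (Fin n → C.X.functionField) where
  carrier := {v | ∃ c : Fin n → C.localIntegers x,
    (fun i ↦ algebraMap C.X.functionField (C.LocalField x) (v i)) =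
      A.val *ᵥ fun i ↦ (c i : C.LocalField x)}
  zero_mem' := ⟨0, by
    simp only [Pi.zero_apply, map_zero, ZeroMemClass.coe_zero]
    exact (A.val.mulVec_zero).symm⟩
  add_mem' := by
    rintro v w ⟨c, hc⟩ ⟨d, hd⟩
    refine ⟨c + d, ?_⟩
    have h := congrArg₂ (· + ·) hc hd
    rw [← Matrix.mulVec_add] at h
    refine Eq.trans ?_ h
    funext i
    exact map_add _ _ _
  smul_mem' := by
    rintro r v ⟨c, hc⟩
    let a : C.localIntegers x := ⟨_, C.algebraMap_stalk_mem x r⟩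
    refine ⟨a • c, ?_⟩
    have h := congrArg ((a : C.LocalField x) • ·) hc
    rw [← Matrix.mulVec_smul] at h
    refine Eq.trans ?_ h
    funext i
    exact (congrArg _ (Algebra.smul_def r (v i))).trans (map_mul _ _ _)

variable (g : GL (Fin n) C.Adeles)

/-- The sections over an open subset of the vector bundle of an adelic matrix `g`: constant
functions with values in `Fⁿ` which belong to the lattice `g_x 𝒪_xⁿ` at every closed point `x`. -/
def adelicSections (U : C.X.Opens) : AddSubgroup (U → Fin n → C.X.functionField) where
  carrier := {f | (∀ x y, f x = f y) ∧
    ∀ (x : C.Place) (hx : x.1 ∈ U), f ⟨x.1, hx⟩ ∈ lattice x (localGL n x g)}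
  zero_mem' := ⟨fun _ _ ↦ rfl, fun _ _ ↦ zero_mem _⟩
  add_mem' := fun ⟨h1, h2⟩ ⟨h3, h4⟩ ↦
    ⟨fun x y ↦ congrArg₂ (· + ·) (h1 x y) (h3 x y), fun x hx ↦ add_mem (h2 x hx) (h4 x hx)⟩
  neg_mem' := fun ⟨h1, h2⟩ ↦
    ⟨fun x y ↦ congrArg (- ·) (h1 x y), fun x hx ↦ neg_mem (h2 x hx)⟩

/-- The germ at the generic point of a regular function on an open subset containing `x`. -/
noncomputable def germGeneric {U : C.X.Opens} (x : U) : Γ(C.X, U) →+* C.X.functionField :=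
  (C.X.presheaf.germ U (genericPoint C.X) (genericPoint_mem x.2)).hom

noncomputable instance (U : C.X.Opens) : SMul Γ(C.X, U) (adelicSections g U) where
  smul r s := ⟨fun x ↦ germGeneric x r • s.1 x, fun x y ↦ congrArg (germGeneric x r • ·) (s.2.1 x y),
    fun x hx ↦ by
      have := (lattice x (localGL n x g)).smul_mem (C.X.presheaf.germ U x.1 hx r) (s.2.2 x hx)
      rwa [← algebraMap_smul C.X.functionField, algebraMap_germ] at this⟩

theorem adelicSections_smul_apply {U : C.X.Opens} (r : Γ(C.X, U)) (s : adelicSections g U)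
    (x : U) : (r • s).1 x = germGeneric x r • s.1 x := rfl

noncomputable instance (U : C.X.Opens) : Module Γ(C.X, U) (adelicSections g U) where
  one_smul s := Subtype.ext <| funext fun x ↦ by rw [adelicSections_smul_apply, map_one, one_smul]
  mul_smul r r' s := Subtype.ext <| funext fun x ↦ by
    simp only [adelicSections_smul_apply, map_mul, mul_smul]
  smul_zero r := Subtype.ext <| funext fun x ↦ smul_zero _
  smul_add r s s' := Subtype.ext <| funext fun x ↦ smul_add _ _ _
  add_smul r r' s := Subtype.ext <| funext fun x ↦ by
    rw [adelicSections_smul_apply, map_add, add_smul]; rfl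
  zero_smul s := Subtype.ext <| funext fun x ↦ by
    rw [adelicSections_smul_apply, map_zero, zero_smul]; rfl

/-- Restriction of sections of the vector bundle of an adelic matrix. -/
def adelicRestrict {U V : C.X.Opens} (i : V ⟶ U) : adelicSections g U →+ adelicSections g V where
  toFun s := ⟨fun x ↦ s.1 ⟨x.1, leOfHom i x.2⟩, fun _ _ ↦ s.2.1 _ _,
    fun x hx ↦ s.2.2 x (leOfHom i hx)⟩
  map_zero' := rfl
  map_add' _ _ := rfl

/-- The sheaf condition for the vector bundle of an adelic matrix. -/
def adelicPredicate : TopCat.LocalPredicate fun _ : C.X ↦ Fin n → C.X.functionField where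
  pred {U} f := f ∈ adelicSections g U
  res i f h := (adelicRestrict g i ⟨f, h⟩).2
  locality {U} f h := by
    choose V hV i hf using h
    refine ⟨fun x y ↦ ?_, fun x hx ↦ (hf ⟨x.1, hx⟩).2 x (hV _)⟩
    -- Local constancy implies constancy: both values equal the value at the generic point, which
    -- lies in every nonempty open set.
    refine ((hf x).1 ⟨x.1, hV x⟩ ⟨genericPoint C.X, genericPoint_mem (hV x)⟩).trans ?_
    exact (hf y).1 ⟨genericPoint C.X, genericPoint_mem (hV y)⟩ ⟨y.1, hV y⟩

/-- The presheaf of abelian groups underlying the vector bundle of an adelic matrix. -/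
noncomputable def adelicPresheaf : TopCat.Presheaf Ab.{u} C.X where
  obj U := AddCommGrpCat.of (adelicSections g U.unop)
  map i := AddCommGrpCat.ofHom (adelicRestrict g i.unop)

/-- The underlying presheaf of sets is cut out of all functions by a local predicate. Using constant
functions rather than vectors also makes the sections over the empty set trivial. -/
theorem adelicPresheaf_isSheaf : (adelicPresheaf g).IsSheaf := by
  rw [TopCat.Presheaf.isSheaf_iff_isSheaf_comp (CategoryTheory.forget Ab)]
  exact TopCat.Presheaf.isSheaf_of_iso (NatIso.ofComponents fun U ↦ Iso.refl _)
    (TopCat.subpresheafToTypes.isSheaf (adelicPredicate g))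

noncomputable instance (U : (C.X.Opens)ᵒᵖ) :
    Module (C.X.ringCatSheaf.obj.obj U) ((adelicPresheaf g).obj U) :=
  inferInstanceAs (Module Γ(C.X, U.unop) (adelicSections g U.unop))

/-- The `𝒪_X`-module of an adelic matrix. -/
noncomputable def adelicModule : C.X.Modules where
  val := PresheafOfModules.ofPresheaf (adelicPresheaf g) fun U V i r s ↦
    Subtype.ext <| funext fun x ↦ by
      have h : germGeneric (U := U.unop) ⟨x.1, leOfHom i.unop x.2⟩ r =
          germGeneric x (C.X.presheaf.map i r) :=
        (C.X.presheaf.germ_res_apply i.unop _ (genericPoint_mem x.2) r).symm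
      exact congrArg (· • _) h
  isSheaf := adelicPresheaf_isSheaf g

end SmoothProjectiveCurve

namespace SmoothProjectiveCurve

open AlgebraicGeometry.Scheme.Modules

variable {k : Type u} [Field k] {C : SmoothProjectiveCurve k} {n : ℕ}

/-! ### A vector bundle is determined by its transition matrix -/

variable {V : C.VectorBundle n} {g : GL (Fin n) C.Adeles} {t : Trivialization V}

theorem Trivialization.IsTransition.comparison_sum_smul (ht : t.IsTransition g) (x : C.Place)
    (c : Fin n → C.localIntegers x) :
    comparison V.obj x (∑ j, c j • t.formal x j) =
      ∑ i, ((localGL n x g).val.mulVec fun j ↦ (c j : C.LocalField x)) i •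
        (1 : C.LocalField x) ⊗ₜ[C.X.functionField] t.generic i := by
  rw [Trivialization.isTransition_iff] at ht
  simp only [SmoothProjectiveCurve.comparison_sum_smul, ht, Finset.smul_sum, smul_smul,
    Matrix.mulVec, dotProduct, Finset.sum_smul]
  rw [Finset.sum_comm]
  simp only [mul_comm]

theorem sum_smul_one_tmul_injective {M : Type*} [AddCommGroup M] [Module C.X.functionField M]
    (x : C.Place) (e : Module.Basis (Fin n) C.X.functionField M) {a b : Fin n → C.LocalField x}
    (h : ∑ i, a i • (1 : C.LocalField x) ⊗ₜ[C.X.functionField] e i =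
      ∑ i, b i • (1 : C.LocalField x) ⊗ₜ[C.X.functionField] e i) : a = b := by
  funext i
  have h5 := congrArg (fun z ↦ (e.baseChange (C.LocalField x)).repr z i) h
  simpa [Finsupp.single_apply, ← Module.Basis.baseChange_apply] using h5

theorem one_tmul_eq_sum {M : Type*} [AddCommGroup M] [Module C.X.functionField M]
    (x : C.Place) (e : Module.Basis (Fin n) C.X.functionField M) (m : M) :
    (1 : C.LocalField x) ⊗ₜ[C.X.functionField] m =
      ∑ i, algebraMap C.X.functionField (C.LocalField x) (e.equivFun m i) •
        (1 : C.LocalField x) ⊗ₜ[C.X.functionField] e i := by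
  rw [← tmul_sum_smul, e.sum_equivFun]

/-- Descent from the completion: a generic vector in the formal lattice has, in a frame of `V` near
`x`, coordinates lying in both `F` and `𝒪_x`. These belong to the local ring at `x`, so the vector
comes from the uncompleted stalk. -/
theorem equivFun_mem_lattice_iff (ht : t.IsTransition g) (x : C.Place)
    (m : stalk V.obj (genericPoint C.X)) :
    t.generic.equivFun m ∈ lattice x (localGL n x g) ↔
      m ∈ (specialization V.obj x.1).range := by
  constructor
  · rintro ⟨c, hc⟩
    have h1 := ht.comparison_sum_smul x c
    rw [← hc, ← one_tmul_eq_sum] at h1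
    obtain ⟨U, hU, s, hs⟩ := (isVectorBundle_iff V.obj).mp V.property x.1
    obtain ⟨b, hb⟩ := IsFrame.exists_stalk_basis hs hU
    obtain ⟨e, he⟩ := IsFrame.exists_stalk_basis hs (genericPoint_mem hU)
    obtain ⟨f, hf⟩ := IsFrame.exists_formal_basis hs hU
    rw [← f.sum_equivFun (∑ j, c j • t.formal x j), SmoothProjectiveCurve.comparison_sum_smul,
      one_tmul_eq_sum x e] at h1
    simp only [hf, ← he] at h1
    have h2 := sum_smul_one_tmul_injective x e h1
    have h3 (i : Fin n) : e.equivFun m i ∈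
        (algebraMap (C.X.presheaf.stalk x.1) C.X.functionField).range :=
      mem_range_of_mem_localIntegers (congrFun h2 i ▸ SetLike.coe_mem _)
    choose r hr using h3
    refine ⟨∑ i, r i • b i, ?_⟩
    rw [map_sum, ← e.sum_equivFun m]
    refine Finset.sum_congr rfl fun i _ ↦ ?_
    rw [specialization_smul, hr, hb, specialization_germ, he]
  · rintro ⟨m, rfl⟩
    refine ⟨(t.formal x).equivFun (1 ⊗ₜ m), ?_⟩
    refine sum_smul_one_tmul_injective x t.generic ?_
    rw [← ht.comparison_sum_smul, Module.Basis.sum_equivFun, ← one_tmul_eq_sum]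
    rfl

/-- The coordinates, with respect to a generic frame, of the sections of a vector bundle. -/
noncomputable def Trivialization.IsTransition.toAdelicSections (ht : t.IsTransition g)
    (U : C.X.Opens) : Γ(V.obj, U) →+ adelicSections g U where
  toFun s := ⟨fun y ↦ t.generic.equivFun
    (V.obj.presheaf.germ U (genericPoint C.X) (genericPoint_mem y.2) s : stalk V.obj _),
    fun _ _ ↦ rfl, fun x hx ↦ (equivFun_mem_lattice_iff ht x _).mpr
      ⟨V.obj.presheaf.germ U x.1 hx s, specialization_germ V.obj hx s⟩⟩
  map_zero' := Subtype.ext <| funext fun y ↦ by simp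
  map_add' s s' := Subtype.ext <| funext fun y ↦ by simp

/-- The morphism from a vector bundle to the `𝒪_X`-module of one of its transition matrices. -/
noncomputable def Trivialization.IsTransition.toAdelicModule (ht : t.IsTransition g) :
    V.obj ⟶ adelicModule g :=
  ⟨PresheafOfModules.homMk
    { app U := AddCommGrpCat.ofHom (ht.toAdelicSections U.unop)
      naturality U W i := by
        ext s
        refine Subtype.ext <| funext fun y ↦ ?_
        exact congrArg t.generic.equivFun (germ_map_apply V.obj i.unop (genericPoint_mem y.2) s) }
    fun U r s ↦ Subtype.ext <| funext fun y ↦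
      (congrArg t.generic.equivFun (germ_smul_stalk V.obj _ U.unop (genericPoint_mem y.2) r s)).trans
        (map_smul t.generic.equivFun _ _)⟩

/-- Sections are determined by their generic germs. Conversely, the lattice conditions lift a
generic vector to the stalk at each closed point of `U`, hence to local sections with the same
generic germ, and these glue. -/
theorem Trivialization.IsTransition.toAdelicSections_bijective (ht : t.IsTransition g)
    (U : C.X.Opens) : Function.Bijective (ht.toAdelicSections U) := by
  constructor
  · intro s s' h
    refine eq_of_germ_genericPoint_eq V.property s s' fun hU ↦ ?_
    exact t.generic.equivFun.injective (congrFun (congrArg Subtype.val h) ⟨_, hU⟩)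
  · intro σ
    by_cases hU : genericPoint C.X ∈ U
    · obtain ⟨m, hm⟩ := t.generic.equivFun.surjective (σ.1 ⟨_, hU⟩)
      obtain ⟨s, hs⟩ := exists_section_of_locally V.property (W := U) m fun x hx ↦ by
        obtain hc | rfl := isClosed_or_eq_genericPoint x
        · have h := σ.2.2 ⟨x, hc⟩ hx
          rw [σ.2.1 _ ⟨_, hU⟩, ← hm, equivFun_mem_lattice_iff ht] at h
          obtain ⟨b, rfl⟩ := h
          obtain ⟨W, hW, s, rfl⟩ := V.obj.presheaf.exists_germ_eq b
          exact ⟨W, hW, s, (specialization_germ V.obj hW s).symm⟩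
        · exact V.obj.presheaf.exists_germ_eq m
      refine ⟨s, Subtype.ext <| funext fun y ↦ ?_⟩
      rw [σ.2.1 y ⟨_, hU⟩, ← hm, ← hs hU]
      rfl
    · exact ⟨0, Subtype.ext <| funext fun y ↦ (hU (genericPoint_mem y.2)).elim⟩

theorem Trivialization.IsTransition.nonempty_iso (ht : t.IsTransition g) :
    Nonempty (V.obj ≅ adelicModule g) := by
  have : IsIso ht.toAdelicModule := by
    rw [Hom.isIso_iff_isIso_app]
    intro U
    rw [ConcreteCategory.isIso_iff_bijective]
    exact ht.toAdelicSections_bijective U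
  exact ⟨asIso ht.toAdelicModule⟩

end SmoothProjectiveCurve

namespace SmoothProjectiveCurve

open AlgebraicGeometry.Scheme.Modules

variable {k : Type u} [Field k] {C : SmoothProjectiveCurve k} {n : ℕ}

/-! ### Approximation of local matrices by rational ones -/

theorem isOpen_localIntegers (x : C.Place) :
    IsOpen (C.localIntegers x : Set (C.LocalField x)) :=
  Valued.isOpen_valuationSubring _

/-- The matrices over the function field are dense in the matrices over its completion at a closed
point, and the integral invertible matrices are open. -/
theorem exists_functionFieldGL_eq (x : C.Place) (A : GL (Fin n) (C.LocalField x)) :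
    ∃ h : GL (Fin n) C.X.functionField, A⁻¹ * functionFieldGL n x h ∈ (integersGL n x).range := by
  let K := C.LocalField x
  -- `A⁻¹ H` lies in `GL_n(𝒪_x)` when its entries are integral, its determinant is nonzero and the
  -- inverse determinant is integral. These conditions hold for all `H` near `A`, where `A⁻¹ H` is
  -- near `1`, so by density a rational `H` satisfies them.
  let φ (H : Matrix (Fin n) (Fin n) K) : Matrix (Fin n) (Fin n) K := A⁻¹.val * H
  have hφ : Continuous φ := continuous_const.matrix_mul continuous_id
  have hφA : φ A.val = 1 := A.inv_mul
  have hint (a : K) (ha : a ∈ C.localIntegers x) : (C.localIntegers x : Set K) ∈ nhds a :=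
    (isOpen_localIntegers x).mem_nhds ha
  have h1 : ∀ᶠ H in nhds A.val, ∀ i j, φ H i j ∈ C.localIntegers x := by
    simp only [Filter.eventually_all]
    intro i j
    refine (hφ.matrix_elem i j).continuousAt.eventually (hint _ ?_)
    have h0 : φ A.val i j = (1 : Matrix (Fin n) (Fin n) K) i j := by rw [hφA]
    change φ A.val i j ∈ C.localIntegers x
    rw [h0, Matrix.one_apply]
    split_ifs
    exacts [one_mem _, zero_mem _]
  have hdet : ContinuousAt (fun H ↦ (φ H).det) A.val := hφ.matrix_det.continuousAt
  have hdetA : (φ A.val).det = 1 := by rw [hφA, Matrix.det_one]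
  have h2 : ∀ᶠ H in nhds A.val, (φ H).det ≠ 0 :=
    hdet.eventually_ne (by rw [hdetA]; exact one_ne_zero)
  have h3 : ∀ᶠ H in nhds A.val, (φ H).det⁻¹ ∈ C.localIntegers x := by
    refine (hdet.inv₀ (by rw [hdetA]; exact one_ne_zero)).eventually (hint _ ?_)
    change (φ A.val).det⁻¹ ∈ C.localIntegers x
    rw [hdetA, inv_one]
    exact one_mem _
  have hdense : DenseRange fun H : Matrix (Fin n) (Fin n) C.X.functionField ↦
      H.map (algebraMap C.X.functionField K) :=
    .piMap fun _ ↦ .piMap fun _ ↦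
      IsDedekindDomain.HeightOneSpectrum.denseRange_algebraMap C.X.functionField (C.maxIdeal x)
  obtain ⟨H, h1, h2, h3⟩ := hdense.mem_nhds (h1.and (h2.and h3))
  have hH : IsUnit H := by
    rw [Matrix.isUnit_iff_isUnit_det, isUnit_iff_ne_zero]
    intro h0
    apply h2
    rw [Matrix.det_mul, show (H.map (algebraMap C.X.functionField K)).det =
      algebraMap C.X.functionField K H.det from (RingHom.map_det _ _).symm, h0, map_zero, mul_zero]
  obtain ⟨h, rfl⟩ := hH
  refine ⟨h, ?_⟩
  let B : Matrix (Fin n) (Fin n) (C.localIntegers x) := .of fun i j ↦ ⟨_, h1 i j⟩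
  have hB : B.map (C.localIntegers x).subtype = (A⁻¹ * functionFieldGL n x h).val := rfl
  have hBdet : (C.localIntegers x).subtype B.det = (A⁻¹ * functionFieldGL n x h).val.det := by
    rw [RingHom.map_det]; rfl
  have hBu : IsUnit B := by
    rw [Matrix.isUnit_iff_isUnit_det]
    refine IsUnit.of_mul_eq_one (⟨_, h3⟩ : C.localIntegers x) (Subtype.ext ?_)
    refine (congrArg (· * _) hBdet).trans (mul_inv_cancel₀ h2)
  obtain ⟨b, hb⟩ := hBu
  refine ⟨b, Units.ext ?_⟩
  rw [← hB, ← hb]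
  rfl

/-! ### Local frames of the vector bundle of an adelic matrix -/

/-- For a rational matrix the coordinates `h⁻¹ v` already lie in `F` and do not depend on `x`, which
is the form that `exists_regular` needs. -/
theorem mem_lattice_functionFieldGL {x : C.Place} {h : GL (Fin n) C.X.functionField}
    {v : Fin n → C.X.functionField} : v ∈ lattice x (functionFieldGL n x h) ↔
      ∀ i, algebraMap C.X.functionField (C.LocalField x) (h⁻¹.val.mulVec v i) ∈
        C.localIntegers x := by
  have key (w : Fin n → C.X.functionField) (H : GL (Fin n) C.X.functionField) :
      (fun i ↦ algebraMap C.X.functionField (C.LocalField x) (H.val.mulVec w i)) =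
        (functionFieldGL n x H).val.mulVec
          fun i ↦ algebraMap C.X.functionField (C.LocalField x) (w i) :=
    funext fun i ↦ RingHom.map_mulVec _ _ _ _
  constructor
  · rintro ⟨c, hc⟩ i
    have h1 := congrFun (key v h⁻¹) i
    rw [hc, Matrix.mulVec_mulVec, map_inv, Units.inv_mul, Matrix.one_mulVec] at h1
    rw [h1]
    exact (c i).2
  · intro hi
    refine ⟨fun i ↦ ⟨_, hi i⟩, ?_⟩
    change _ = (functionFieldGL n x h).val.mulVec fun i ↦ _
    rw [← key, Matrix.mulVec_mulVec, Units.mul_inv, Matrix.one_mulVec]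

theorem lattice_mul_integersGL (x : C.Place) (A : GL (Fin n) (C.LocalField x))
    (b : GL (Fin n) (C.localIntegers x)) : lattice x (A * integersGL n x b) = lattice x A := by
  have key (A : GL (Fin n) (C.LocalField x)) (b : GL (Fin n) (C.localIntegers x)) :
      lattice x (A * integersGL n x b) ≤ lattice x A := by
    rintro v ⟨c, hc⟩
    refine ⟨b.val.mulVec c, ?_⟩
    have h1 : (fun i ↦ ((b.val.mulVec c i : C.localIntegers x) : C.LocalField x)) =
        (integersGL n x b).val.mulVec fun i ↦ (c i : C.LocalField x) :=
      funext fun i ↦ RingHom.map_mulVec (C.localIntegers x).subtype _ _ _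
    rw [h1, Matrix.mulVec_mulVec, hc]
    rfl
  refine le_antisymm (key A b) ?_
  simpa [mul_assoc, ← map_mul] using key (A * integersGL n x b) b⁻¹

variable {g : GL (Fin n) C.Adeles} {U : C.X.Opens} {h : GL (Fin n) C.X.functionField}

theorem lattice_eq_of_mem_range {x : C.Place}
    (hx : (localGL n x g)⁻¹ * functionFieldGL n x h ∈ (integersGL n x).range) :
    lattice x (localGL n x g) = lattice x (functionFieldGL n x h) := by
  obtain ⟨b, hb⟩ := hx
  rw [← lattice_mul_integersGL x (localGL n x g) b, hb, mul_inv_cancel_left]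

/-- The columns of an invertible matrix over the function field, as sections of the vector bundle
of an adelic matrix. -/
def columnSection
    (hU : ∀ x : C.Place, x.1 ∈ U →
      (localGL n x g)⁻¹ * functionFieldGL n x h ∈ (integersGL n x).range) (j : Fin n) :
    adelicSections g U :=
  ⟨fun _ i ↦ h.val i j, fun _ _ ↦ rfl, fun x hx ↦ by
    rw [lattice_eq_of_mem_range (hU x hx), mem_lattice_functionFieldGL]
    intro i
    have h1 : h⁻¹.val.mulVec (fun i ↦ h.val i j) i = (1 : Matrix (Fin n) (Fin n) _) i j := by
      rw [← h.inv_mul]; rfl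
    rw [h1, Matrix.one_apply]
    split_ifs
    · rw [map_one]; exact one_mem _
    · rw [map_zero]; exact zero_mem _⟩

theorem adelicSections_sum_apply {W : C.X.Opens} (c : Fin n → Γ(C.X, W))
    (s : Fin n → adelicSections g W) (y : W) :
    (∑ i, c i • s i).1 y = ∑ i, germGeneric y (c i) • (s i).1 y := by
  rw [AddSubgroup.val_finsetSum, Finset.sum_apply]
  rfl

/-- Over `U` the lattices of `g` are those of `h`. The coordinates `h⁻¹ v` of a section are thus
integral at all closed points of its domain, so they are regular functions. -/
theorem isFrame_columnSection
    (hU : ∀ x : C.Place, x.1 ∈ U →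
      (localGL n x g)⁻¹ * functionFieldGL n x h ∈ (integersGL n x).range) :
    IsFrame (M := adelicModule g) (U := U) (columnSection hU) := by
  intro W i m
  have key (c : Fin n → Γ(C.X, W)) (y : W) :
      ((∑ j, c j • adelicRestrict g i (columnSection hU j) : adelicSections g W)).1 y =
        h.val.mulVec fun j ↦ germGeneric y (c j) := by
    rw [adelicSections_sum_apply]
    funext l
    simp only [Finset.sum_apply, Pi.smul_apply, smul_eq_mul, Matrix.mulVec, dotProduct]
    exact Finset.sum_congr rfl fun j _ ↦ mul_comm _ _
  change ∃! c : Fin n → Γ(C.X, W), (m : adelicSections g W) =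
    ∑ j, c j • adelicRestrict g i (columnSection hU j)
  by_cases hW : genericPoint C.X ∈ W
  · have hr (j : Fin n) := exists_regular (W := W)
      (h⁻¹.val.mulVec ((m : adelicSections g W).1 ⟨_, hW⟩) j) fun x hx ↦ by
        have h1 := (m : adelicSections g W).2.2 x hx
        rw [lattice_eq_of_mem_range (hU x (leOfHom i hx)),
          (m : adelicSections g W).2.1 _ ⟨_, hW⟩, mem_lattice_functionFieldGL] at h1
        exact h1 j
    choose r hr using hr
    refine ⟨r, Subtype.ext <| funext fun y ↦ ?_, fun c hc ↦ funext fun j ↦ ?_⟩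
    · rw [key, (m : adelicSections g W).2.1 y ⟨_, hW⟩]
      have h2 : (fun j ↦ germGeneric y (r j)) =
          h⁻¹.val.mulVec ((m : adelicSections g W).1 ⟨_, hW⟩) := funext fun j ↦ hr j hW
      rw [h2, Matrix.mulVec_mulVec, Units.mul_inv, Matrix.one_mulVec]
    · apply germ_genericPoint_injective hW
      rw [hr j hW, hc, key, Matrix.mulVec_mulVec, Units.inv_mul, Matrix.one_mulVec]
      rfl
  -- An open set missing the generic point is empty; sections and functions over it are all zero.
  · have hW' (y : C.X) : y ∉ W := fun hy ↦ hW (genericPoint_mem hy)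
    obtain rfl : W = ⊥ := by ext y; simpa using hW' y
    exact ⟨0, Subtype.ext <| funext fun y ↦ (hW' _ y.2).elim, fun c hc ↦ Subsingleton.elim _ _⟩

end SmoothProjectiveCurve

namespace SmoothProjectiveCurve

open AlgebraicGeometry.Scheme.Modules

variable {k : Type u} [Field k] {C : SmoothProjectiveCurve k} {n : ℕ}

/-! ### The trivialization of the vector bundle of an adelic matrix -/

theorem finite_not_mem_range (g : GL (Fin n) C.Adeles) (h : GL (Fin n) C.X.functionField) :
    {x : C.Place | (localGL n x g)⁻¹ * functionFieldGL n x h ∉ (integersGL n x).range}.Finite := by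
  have := eventually_mem_range_integersGL
    (g⁻¹ * Matrix.GeneralLinearGroup.map C.diagonal h)
  simp only [map_mul, map_inv, localGL_map_diagonal] at this
  exact this

/-- Choose `h` approximating `g_x`. The matrix `g⁻¹ h` fails to be integral and invertible at only
finitely many closed points, none of them `x`; removing them leaves the required neighbourhood. -/
theorem exists_functionFieldGL_nhds (g : GL (Fin n) C.Adeles) (x : C.Place) :
    ∃ (U : C.X.Opens) (_ : x.1 ∈ U) (h : GL (Fin n) C.X.functionField), ∀ y : C.Place, y.1 ∈ U →
      (localGL n y g)⁻¹ * functionFieldGL n y h ∈ (integersGL n y).range := by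
  obtain ⟨h, hh⟩ := exists_functionFieldGL_eq x (localGL n x g)
  refine ⟨complOfFinite (finite_not_mem_range g h), fun y hy hxy ↦ ?_, h, fun y hy ↦ ?_⟩
  · obtain rfl : x = y := Subtype.ext hxy
    exact hy hh
  · by_contra hy'
    exact hy y hy' rfl

theorem exists_nhds_genericPoint (g : GL (Fin n) C.Adeles) :
    ∃ (U : C.X.Opens) (_ : genericPoint C.X ∈ U), ∀ y : C.Place, y.1 ∈ U →
      (localGL n y g)⁻¹ * functionFieldGL n y 1 ∈ (integersGL n y).range := by
  refine ⟨complOfFinite (finite_not_mem_range g 1), genericPoint_mem_complOfFinite _,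
    fun y hy ↦ ?_⟩
  by_contra hy'
  exact hy y hy' rfl

theorem isVectorBundle_adelicModule (g : GL (Fin n) C.Adeles) :
    C.IsVectorBundle n (adelicModule g) := by
  rw [isVectorBundle_iff]
  intro x
  obtain hc | rfl := isClosed_or_eq_genericPoint x
  · obtain ⟨U, hx, h, hU⟩ := exists_functionFieldGL_nhds g ⟨x, hc⟩
    exact ⟨U, hx, _, isFrame_columnSection hU⟩
  · obtain ⟨U, hx, hU⟩ := exists_nhds_genericPoint g
    exact ⟨U, hx, _, isFrame_columnSection hU⟩

/-- The vector bundle of an adelic matrix. -/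
noncomputable def adelicBundle (g : GL (Fin n) C.Adeles) : C.VectorBundle n :=
  ⟨adelicModule g, isVectorBundle_adelicModule g⟩

/-- The germ at the generic point of a section of the vector bundle of an adelic matrix. -/
noncomputable def adelicGerm (g : GL (Fin n) C.Adeles) {U : C.X.Opens} (hU : genericPoint C.X ∈ U)
    (s : adelicSections g U) : stalk (adelicModule g) (genericPoint C.X) :=
  (adelicModule g).presheaf.germ U (genericPoint C.X) hU s

theorem adelicGerm_restrict (g : GL (Fin n) C.Adeles) {U V : C.X.Opens} (i : V ⟶ U)
    (hV : genericPoint C.X ∈ V) (s : adelicSections g U) :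
    adelicGerm g hV (adelicRestrict g i s) = adelicGerm g (leOfHom i hV) s :=
  germ_map_apply (adelicModule g) i hV s

/-- The standard basis of `Fⁿ`, as a basis of the generic stalk of the vector bundle of an adelic
matrix. -/
theorem exists_generic_basis (g : GL (Fin n) C.Adeles) :
    ∃ e : Module.Basis (Fin n) C.X.functionField (stalk (adelicModule g) (genericPoint C.X)),
      ∀ (U : C.X.Opens) (hU : genericPoint C.X ∈ U) (s : adelicSections g U),
        adelicGerm g hU s = ∑ i, s.1 ⟨_, hU⟩ i • e i := by
  -- Near the generic point `h = 1` is allowed, and its columns are the standard vectors of `F^n`.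
  obtain ⟨U₀, h₀, hU₀⟩ := exists_nhds_genericPoint g
  obtain ⟨e, he⟩ := IsFrame.exists_stalk_basis (isFrame_columnSection hU₀) h₀
  refine ⟨e, fun U hU s ↦ ?_⟩
  -- The coordinates of `s` are elements of `F`, that is, generic germs; on a small enough `V` they
  -- become regular functions, which are the coefficients of `s` in the frame.
  obtain ⟨V, hVU, hV, ρ, hρ⟩ := exists_germ_eq_family (s.1 ⟨_, hU⟩)
    (U := U ⊓ U₀) (x := genericPoint C.X) ⟨hU, h₀⟩
  let i : V ⟶ U := homOfLE (hVU.trans inf_le_left)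
  let i₀ : V ⟶ U₀ := homOfLE (hVU.trans inf_le_right)
  have h1 : adelicRestrict g i s = ∑ j, ρ j • adelicRestrict g i₀ (columnSection hU₀ j) := by
    refine Subtype.ext <| funext fun y ↦ ?_
    rw [adelicSections_sum_apply]
    have h2 : (adelicRestrict g i s).1 y = s.1 ⟨_, hU⟩ := s.2.1 _ _
    have h3 (j : Fin n) : germGeneric y (ρ j) = s.1 ⟨_, hU⟩ j := hρ j
    rw [h2]
    funext l
    simp only [h3, Finset.sum_apply, Pi.smul_apply, smul_eq_mul]
    have h4 (j : Fin n) : (adelicRestrict g i₀ (columnSection hU₀ j)).1 y l =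
      (1 : Matrix (Fin n) (Fin n) C.X.functionField) l j := rfl
    simp [h4, Matrix.one_apply]
  rw [← adelicGerm_restrict g i hV, h1]
  refine (germ_sum_smul (adelicModule g) hV ρ _).trans (Finset.sum_congr rfl fun j _ ↦ ?_)
  rw [he]
  exact congrArg₂ (· • ·) (hρ j) (adelicGerm_restrict g i₀ hV _)

theorem exists_isTransition_adelicBundle (g : GL (Fin n) C.Adeles) :
    ∃ t : Trivialization (adelicBundle g), t.IsTransition g := by
  obtain ⟨e, he⟩ := exists_generic_basis g
  have key (x : C.Place) : ∃ f : Module.Basis (Fin n) (C.localIntegers x)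
      (CompletedStalk (adelicModule g) x), ∀ j, comparison (adelicModule g) x (f j) =
        ∑ i, (localGL n x g).val i j • (1 : C.LocalField x) ⊗ₜ[C.X.functionField] e i := by
    obtain ⟨U, hx, h, hU⟩ := exists_functionFieldGL_nhds g x
    obtain ⟨f, hf⟩ := IsFrame.exists_formal_basis (isFrame_columnSection hU) hx
    obtain ⟨b, hb⟩ := hU x hx
    -- The frame `f` has transition matrix `h = g_x b`, so `f b⁻¹` has transition matrix `h b⁻¹ =
    -- g_x`.
    obtain ⟨f', hf'⟩ := f.exists_eq_sum_smul b⁻¹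
    refine ⟨f', fun j ↦ ?_⟩
    have hf₂ (j : Fin n) : comparison (adelicModule g) x (f j) =
        ∑ i, (functionFieldGL n x h).val i j •
          (1 : C.LocalField x) ⊗ₜ[C.X.functionField] e i := by
      refine (hf j).trans ((congrArg _ (he U (genericPoint_mem hx) (columnSection hU j))).trans ?_)
      exact tmul_sum_smul x _ _
    have hg : localGL n x g = functionFieldGL n x h * integersGL n x b⁻¹ := by
      rw [map_inv, hb, mul_inv_rev, inv_inv, mul_inv_cancel_left]
    rw [hf', comparison_sum_smul]
    simp only [hf₂]
    rw [hg]
    exact Matrix.sum_smul_sum_smul (functionFieldGL n x h).val (integersGL n x b⁻¹).val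
      (fun i ↦ (1 : C.LocalField x) ⊗ₜ[C.X.functionField] e i) j
  choose f hf using key
  exact ⟨⟨e, f⟩, (Trivialization.isTransition_iff _ _).mpr hf⟩

/-- The tautological trivialization of the bundle of `g` can be transported along an isomorphism;
conversely, any trivialization with matrix `g` identifies `V` with that bundle. -/
theorem mk_adelicBundle_eq_iff (g : GL (Fin n) C.Adeles) (V : C.VectorBundle n) :
    (Quotient.mk _ (adelicBundle g) : C.VectorBundleClass n) = Quotient.mk _ V ↔
      ∃ t : Trivialization V, t.IsTransition g := by
  rw [Quotient.eq]
  constructor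
  · rintro ⟨e⟩
    obtain ⟨t, ht⟩ := exists_isTransition_adelicBundle g
    exact Trivialization.exists_isTransition_of_iso ((C.IsVectorBundle n).ι.mapIso e) ht
  · rintro ⟨t, ht⟩
    obtain ⟨e⟩ := ht.nonempty_iso
    exact ⟨(C.IsVectorBundle n).isoMk e.symm⟩

end SmoothProjectiveCurve

/-! ### The bijection -/

theorem mainTheorem1 {k : Type u} [Field k] (C : SmoothProjectiveCurve k) (n : ℕ) :
    ∃ Φ : C.WeilQuotient n ≃ C.VectorBundleClass n,
      ∀ (g : GL (Fin n) C.Adeles) (V : C.VectorBundle n),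
        Φ (DoubleCoset.mk (C.rationalGL n) (C.integralGL n) g) = Quotient.mk _ V ↔
          ∃ t : SmoothProjectiveCurve.Trivialization V, t.IsTransition g := by
  let ψ (g : GL (Fin n) C.Adeles) : C.VectorBundleClass n :=
    Quotient.mk _ (SmoothProjectiveCurve.adelicBundle g)
  have hψ (g g' : GL (Fin n) C.Adeles) : ψ g = ψ g' ↔
      DoubleCoset.mk (C.rationalGL n) (C.integralGL n) g =
        DoubleCoset.mk (C.rationalGL n) (C.integralGL n) g' := by
    obtain ⟨t', ht'⟩ := SmoothProjectiveCurve.exists_isTransition_adelicBundle g'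
    -- The criterion is applied to the bundle of `g'`, which already has `g'` as a transition
    -- matrix; `g` is another one exactly when it lies in the same double coset.
    refine (SmoothProjectiveCurve.mk_adelicBundle_eq_iff g _).trans ⟨fun ⟨t, ht⟩ ↦ ?_, fun h ↦ ?_⟩
    · exact SmoothProjectiveCurve.mk_eq_of_isTransition ht ht'
    · exact SmoothProjectiveCurve.exists_isTransition_of_mk_eq h.symm ht'
  let Φ : C.WeilQuotient n → C.VectorBundleClass n :=
    Quotient.lift ψ fun g g' h ↦ (hψ g g').mpr (Quotient.sound h)
  have hΦ : Function.Bijective Φ := by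
    constructor
    · rintro ⟨g⟩ ⟨g'⟩ h
      exact (hψ g g').mp h
    · rintro ⟨V⟩
      obtain ⟨g, t, ht⟩ := SmoothProjectiveCurve.exists_isTransition V
      exact ⟨DoubleCoset.mk _ _ g, (SmoothProjectiveCurve.mk_adelicBundle_eq_iff g V).mpr ⟨t, ht⟩⟩
  exact ⟨.ofBijective Φ hΦ, SmoothProjectiveCurve.mk_adelicBundle_eq_iff⟩
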